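/- Let $(R,\mathfrak m)$ be a commutative noetherian local ring with residue field $k$ and $\mathfrak m$-adic completion $\widehat R$. The Loewy length $\ell\ell_R(M)$ of an $R$-module $M$ is the least integer $i\ge 0$ with $\mathfrak m^iM=0$, and $\infty$ if there is none. If $M$ is finitely generated, its Betti numbers are $\beta^R_n(M)=\operatorname{rank}_k\operatorname{Tor}^R_n(M,k)$, and its complexity is $$\operatorname{cx}_R(M)=\inf\{d\in\mathbb N\mid \text{there is a real } a>0 \text{ with } \beta^R_n(M)\le a\,n^{d-1}\text{ for all } n\ge 1\}\in\mathbb N\cup\{\infty\}.$$ A minimal Cohen presentation of $R$ is an isomorphism $\widehat R\cong Q/(f_1,\dots,f_t)$ where $(Q,\mathfrak m_Q)$ is a complete regular local ring, the ideal $I=(f_1,\dots,f_t)$ is contained in $\mathfrak m_Q^2$, and $f_1,\dots,f_t$ is a minimal generating set of $I$ (that is, $I$ cannot be generated by fewer than $t$ elements; $t=0$ is allowed). For $g\in Q$ let $\operatorname{ord}(g)=\sup\{n\ge 0\mid g\in\mathfrak m_Q^n\}$, so $\operatorname{ord}(0)=\infty$. With respect to such a presentation, put $$\operatorname{ord}(R)=\min\{\operatorname{ord}(g)\mid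 g\in I\},\qquad \max\operatorname{ord}(R)=\max\{\operatorname{ord}(g)\mid g\in I\smallsetminus\mathfrak m_QI\},$$ the minimal order of an element of $I$ and the maximal order of a minimal generator of $I$; if $I=0$, then $\operatorname{ord}(R)=\infty$ and we set $\max\operatorname{ord}(R)=0$. **Theorem.** Fix a minimal Cohen presentation $\widehat R\cong Q/(f_1,\dots,f_t)$ of $R$, with $\operatorname{ord}(R)$ and $\max\operatorname{ord}(R)$ computed in it, and a nonzero $R$-module $M$. 1. If $M$ is finitely generated and $\ell\ell_R(M)<\operatorname{ord}(R)$, then $\operatorname{cx}_R(M)\ge t$. 2. If $M$ has finite flat dimension and $\mathfrak mM\ne M$, then $\ell\ell_R(M)\ge\max\operatorname{ord}(R)$. -/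

import Mathlib

open IsLocalRing CategoryTheory
open scoped ENNReal

universe u v

noncomputable section

/-- The Loewy length of a module `M` over a local ring `(R, 𝔪)`: the least `i` with `𝔪 ^ i M = 0`,
and `⊤` if there is no such `i`. -/
def loewyLength (R : Type u) [CommRing R] [IsLocalRing R] (M : Type v) [AddCommGroup M]
    [Module R M] : ℕ∞ :=
  ⨅ (i : ℕ) (_ : maximalIdeal R ^ i • (⊤ : Submodule R M) = ⊥), (i : ℕ∞)

/-- The `n`-th Betti number `rank_k Tor_n^R(M, k)` of `M`, where `k` is the residue field. As the
Tor module is annihilated by the maximal ideal, its dimension over `k` is its length over `R`. -/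
def bettiNumber (R : Type u) [CommRing R] [IsLocalRing R] (M : Type u) [AddCommGroup M]
    [Module R M] (n : ℕ) : ℕ∞ :=
  Module.length R
    (((Tor (ModuleCat.{u} R) n).obj (ModuleCat.of R M)).obj (ModuleCat.of R (ResidueField R)))

/-- The complexity of `M`: the infimum of all `d : ℕ` such that, for some real `a > 0`, the
inequality `β_n(M) ≤ a n ^ (d - 1)` holds for all `n ≥ 1`. -/
def complexity (R : Type u) [CommRing R] [IsLocalRing R] (M : Type u) [AddCommGroup M]
    [Module R M] : ℕ∞ :=
  ⨅ (d : ℕ) (_ : ∃ a : ℝ, 0 < a ∧ ∀ n : ℕ, 1 ≤ n →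
    ((bettiNumber R M n : ℕ∞) : ℝ≥0∞) ≤ ENNReal.ofReal (a * (n : ℝ) ^ ((d : ℤ) - 1))), (d : ℕ∞)

/-- `M` has finite flat dimension: there is an exact sequence
`0 → F n → ⋯ → F 1 → F 0 → M → 0` with all `F i` flat. -/
def HasFiniteFlatDimension (R : Type u) [CommRing R] (M : Type u) [AddCommGroup M]
    [Module R M] : Prop :=
  ∃ (F : ℕ → Type u) (_ : ∀ i, AddCommGroup (F i)) (_ : ∀ i, Module R (F i))
    (d : ∀ i, F (i + 1) →ₗ[R] F i) (ε : F 0 →ₗ[R] M) (n : ℕ),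
    (∀ i, Module.Flat R (F i)) ∧ (∀ i, n < i → Subsingleton (F i)) ∧
    Function.Surjective ε ∧ Function.Exact (d 0) ε ∧
    ∀ i, Function.Exact (d (i + 1)) (d i)

/-- The `𝔪`-adic order of an element `f` of a local ring: the largest `n` with `f ∈ 𝔪 ^ n`, and `⊤`
if `f` lies in every power of `𝔪`. -/
def adicOrder {Q : Type v} [CommRing Q] [IsLocalRing Q] (f : Q) : ℕ∞ :=
  ⨆ (n : ℕ) (_ : f ∈ maximalIdeal Q ^ n), (n : ℕ∞)

/-- A minimal Cohen presentation `R̂ ≅ Q / (f_1, …, f_t)` of a local ring `R`, for a regular local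
ring `Q`: the ring `Q` is complete, the ideal `(f_1, …, f_t)` lies in `𝔪_Q ^ 2` (so that `Q` and `R`
have the same embedding dimension), and it cannot be generated by fewer than `t` elements. -/
structure MinimalCohenPresentation (R : Type u) [CommRing R] [IsLocalRing R]
    (Q : Type v) [CommRing Q] [IsRegularLocalRing Q] (t : ℕ) where
  /-- the relations -/
  f : Fin t → Q
  /-- the isomorphism with the completion -/
  equiv : (Q ⧸ Ideal.span (Set.range f)) ≃+* AdicCompletion (maximalIdeal R) R
  isAdicComplete : IsAdicComplete (maximalIdeal Q) Q
  le_sq : Ideal.span (Set.range f) ≤ maximalIdeal Q ^ 2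
  spanFinrank_eq : (Ideal.span (Set.range f)).spanFinrank = t

namespace MinimalCohenPresentation

variable {R : Type u} [CommRing R] [IsLocalRing R] {Q : Type v} [CommRing Q] [IsRegularLocalRing Q]
  {t : ℕ}

/-- The kernel of `Q → R̂`. -/
def ker (P : MinimalCohenPresentation R Q t) : Ideal Q :=
  Ideal.span (Set.range P.f)

/-- `ord(R)`, computed in a minimal Cohen presentation: the minimal order of an element of the
kernel. It is `⊤` if the kernel is zero. -/
def ord (P : MinimalCohenPresentation R Q t) : ℕ∞ :=
  ⨅ g ∈ P.ker, adicOrder g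

/-- `max ord(R)`, computed in a minimal Cohen presentation: the maximal order of a minimal generator
of the kernel `I`, that is, of an element of `I` outside `𝔪_Q I`. It is `0` if the kernel is zero,
when there are no minimal generators. -/
def maxOrd (P : MinimalCohenPresentation R Q t) : ℕ∞ :=
  ⨆ g ∈ {g | g ∈ P.ker ∧ g ∉ maximalIdeal Q * P.ker}, adicOrder g

end MinimalCohenPresentation

end

/-! Let `c` satisfy `𝔪 ^ c M = 0`, and let `g_i` be part of a minimal generating set of `I`, each of
order greater than `c`. Writing `g_i = ∑ A_ij b_j` with `A_ij ∈ 𝔪_Q ^ c` and `b_j` generating `𝔪_Q`,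
the coefficients `A_ij` give degree one Koszul cycles with coefficients in `𝔪 ^ c`, independent in
Koszul homology. Krull density and Artin–Rees let one choose these cycles over `R` itself instead of
its completion (`exists_relations`).

Adjoin divided power variables to the Koszul complex to kill these cycles, and map the resulting
Tate complex to a projective resolution `P` of `k`. The boundary of a pure divided power monomial
has coefficients in `𝔪 ^ c`, so its image tensored with an element of `M` is a cycle in `M ⊗ P`.
Each `g_i` also gives a degree two cocycle on `P`, hence an operator on `P` that acts on the Tate
complex, up to homotopy, as the derivative in the `i`-th variable. Composites of these operators are
cocycles dual to the monomials (`exists_cocycle_detecting`). Paired with a functional on `M` that is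
nonzero on the chosen element, they show that `Tor_{2N}(M, k)` maps onto a `k`-space with basis the
degree `N` monomials in the `g_i`.

With all `t` generators, the Betti numbers in even degrees dominate a polynomial of degree `t - 1`,
so the complexity is at least `t`. With a single minimal generator of order greater than `c`, Tor is
nonzero in every positive even degree, which finite flat dimension forbids. -/

/-! ### Comparison of complexes of projectives with resolutions. -/

section Lifting

variable {R : Type*} [CommRing R]

/-- A map of modules killed by `δ` lifts along `δ'` when `δ'` and `δ` form an exact pair and the
source is projective. -/
theorem exists_comp_eq_of_exact {A B C D : Type*} [AddCommGroup A] [Module R A]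
    [AddCommGroup B] [Module R B] [AddCommGroup C] [Module R C] [AddCommGroup D] [Module R D]
    [Module.Projective R A] {δ' : B →ₗ[R] C} {δ : C →ₗ[R] D} (h : Function.Exact δ' δ)
    (g : A →ₗ[R] C) (hg : δ ∘ₗ g = 0) : ∃ f : A →ₗ[R] B, δ' ∘ₗ f = g := by
  have hk : ∀ a, g a ∈ LinearMap.range δ' := fun a ↦ (h (g a)).1 (LinearMap.congr_fun hg a)
  obtain ⟨f, hf⟩ := Module.projective_lifting_property δ'.rangeRestrict (g.codRestrict _ hk)
    δ'.surjective_rangeRestrict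
  exact ⟨f, LinearMap.ext fun a ↦ congrArg Subtype.val (LinearMap.congr_fun hf a)⟩

variable {k : Type*} [AddCommGroup k] [Module R k]
  {P : ℕ → Type*} [∀ n, AddCommGroup (P n)] [∀ n, Module R (P n)]
  {δ : ∀ n, P (n + 1) →ₗ[R] P n} {ε : P 0 →ₗ[R] k}
  {A : ℕ → Type*} [∀ n, AddCommGroup (A n)] [∀ n, Module R (A n)] [∀ n, Module.Projective R (A n)]
  {d : ∀ n, A (n + 1) →ₗ[R] A n}

/-- The comparison theorem: a complex of projective modules maps to a resolution. -/
theorem exists_chainMap_lift (hε : Function.Surjective ε) (h0 : Function.Exact (δ 0) ε)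
    (hδ : ∀ n, Function.Exact (δ (n + 1)) (δ n)) (hd : ∀ n, d n ∘ₗ d (n + 1) = 0)
    (α : A 0 →ₗ[R] k) (hα : α ∘ₗ d 0 = 0) :
    ∃ φ : ∀ n, A n →ₗ[R] P n, ε ∘ₗ φ 0 = α ∧ ∀ n, δ n ∘ₗ φ (n + 1) = φ n ∘ₗ d n := by
  obtain ⟨φ0, hφ0⟩ := Module.projective_lifting_property ε α hε
  obtain ⟨φ1, hφ1⟩ := exists_comp_eq_of_exact h0 (φ0 ∘ₗ d 0)
    (by rw [← LinearMap.comp_assoc, hφ0, hα])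
  -- The recursion carries two consecutive components with their commutation relation, which is
  -- exactly what makes the next component liftable.
  have step : ∀ n, ∀ p : {p : (A n →ₗ[R] P n) × (A (n + 1) →ₗ[R] P (n + 1)) //
      δ n ∘ₗ p.2 = p.1 ∘ₗ d n}, ∃ q : {p : (A (n + 1) →ₗ[R] P (n + 1)) ×
      (A (n + 2) →ₗ[R] P (n + 2)) // δ (n + 1) ∘ₗ p.2 = p.1 ∘ₗ d (n + 1)}, q.1.1 = p.1.2 := by
    rintro n ⟨⟨a, b⟩, hp⟩
    obtain ⟨q, hq⟩ := exists_comp_eq_of_exact (hδ n) (b ∘ₗ d (n + 1)) (by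
      rw [← LinearMap.comp_assoc, hp, LinearMap.comp_assoc, hd, LinearMap.comp_zero])
    exact ⟨⟨(b, q), hq⟩, rfl⟩
  choose f hf using step
  let X : ∀ n, {p : (A n →ₗ[R] P n) × (A (n + 1) →ₗ[R] P (n + 1)) // δ n ∘ₗ p.2 = p.1 ∘ₗ d n} :=
    fun n ↦ Nat.rec ⟨(φ0, φ1), hφ1⟩ f n
  refine ⟨fun n ↦ (X n).1.1, hφ0, fun n ↦ ?_⟩
  have : (X (n + 1)).1.1 = (X n).1.2 := hf n (X n)
  simp only [this, (X n).2]

/-- A chain map from a complex of projective modules to a resolution is null-homotopic if it is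
zero on the augmentation. -/
theorem exists_homotopy_zero (h0 : Function.Exact (δ 0) ε)
    (hδ : ∀ n, Function.Exact (δ (n + 1)) (δ n)) (hd : ∀ n, d n ∘ₗ d (n + 1) = 0)
    (γ : ∀ n, A n →ₗ[R] P n) (hγ0 : ε ∘ₗ γ 0 = 0) (hγ : ∀ n, δ n ∘ₗ γ (n + 1) = γ n ∘ₗ d n) :
    ∃ h : ∀ n, A n →ₗ[R] P (n + 1), γ 0 = δ 0 ∘ₗ h 0 ∧
      ∀ n, γ (n + 1) = δ (n + 1) ∘ₗ h (n + 1) + h n ∘ₗ d n := by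
  obtain ⟨h₀, hh₀⟩ := exists_comp_eq_of_exact h0 (γ 0) hγ0
  -- The invariant says that the defect `γ n - δ n ∘ p` vanishes on boundaries. This is the
  -- obstruction to choosing the next homotopy component.
  have step : ∀ n, ∀ p : {p : A n →ₗ[R] P (n + 1) // (γ n - δ n ∘ₗ p) ∘ₗ d n = 0},
      ∃ q : {q : A (n + 1) →ₗ[R] P (n + 2) //
        (γ (n + 1) - δ (n + 1) ∘ₗ q) ∘ₗ d (n + 1) = 0},
        γ (n + 1) = δ (n + 1) ∘ₗ q.1 + p.1 ∘ₗ d n := by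
    rintro n ⟨p, hp⟩
    obtain ⟨q, hq⟩ := exists_comp_eq_of_exact (hδ n) (γ (n + 1) - p ∘ₗ d n) (by
      rw [LinearMap.comp_sub, hγ, ← LinearMap.comp_assoc, ← LinearMap.sub_comp, hp])
    refine ⟨⟨q, ?_⟩, by rw [hq, sub_add_cancel]⟩
    rw [hq, sub_sub_cancel, LinearMap.comp_assoc, hd, LinearMap.comp_zero]
  choose f hf using step
  let X : ∀ n, {p : A n →ₗ[R] P (n + 1) // (γ n - δ n ∘ₗ p) ∘ₗ d n = 0} :=
    fun n ↦ Nat.rec ⟨h₀, by rw [hh₀, sub_self, LinearMap.zero_comp]⟩ f n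
  exact ⟨fun n ↦ (X n).1, hh₀.symm, fun n ↦ hf n (X n)⟩

end Lifting

noncomputable section

/-! ### The Tate construction -/

section Tate

variable {R : Type*} [CommRing R] {V : Type*} [AddCommGroup V] [Module R V] {σ : Type*}

/-- Freeness makes the Tate module projective, so that it can be the source in the comparison
theorems. -/
instance [Module.Free R V] : Module.Free R (ExteriorAlgebra R V) := by
  classical
  have ⟨I, b⟩ := Module.Free.exists_basis R V
  let : LinearOrder I := linearOrderOfSTO WellOrderingRel
  exact Module.Free.of_basis b.ExteriorAlgebra

variable (R V σ) in
/-- The module underlying the algebra obtained from the exterior algebra of `V` by adjoining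
divided powers variables indexed by `σ`; divided power monomials correspond to multisets. -/
abbrev TateModule : Type _ := Multiset σ →₀ ExteriorAlgebra R V

namespace TateModule

variable (R V) in
/-- The derivative with respect to a divided powers variable. -/
def partialDeriv (i : σ) : TateModule R V σ →ₗ[R] TateModule R V σ :=
  Finsupp.lcomapDomain (i ::ₘ ·) fun _ _ ↦ (Multiset.cons_inj_right i).1

@[simp]
theorem partialDeriv_apply (i : σ) (t : TateModule R V σ) (b : Multiset σ) :
    partialDeriv R V i t b = t (i ::ₘ b) := rfl

/-- Application of an endomorphism of the exterior algebra to all coefficients. -/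
abbrev mapCoeff (f : ExteriorAlgebra R V →ₗ[R] ExteriorAlgebra R V) :
    TateModule R V σ →ₗ[R] TateModule R V σ :=
  Finsupp.mapRange.linearMap f

theorem mapCoeff_mem_smul_top {𝔞 : Ideal R} {f : ExteriorAlgebra R V →ₗ[R] ExteriorAlgebra R V}
    (hf : ∀ ω, f ω ∈ 𝔞 • (⊤ : Submodule R (ExteriorAlgebra R V))) (t : TateModule R V σ) :
    mapCoeff f t ∈ 𝔞 • (⊤ : Submodule R (TateModule R V σ)) := by
  induction t using Finsupp.induction_linear with
  | zero => simp
  | add t u ht hu => rw [map_add]; exact add_mem ht hu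
  | single b ω =>
    have := Submodule.mem_map_of_mem (f := Finsupp.lsingle (R := R) b) (hf ω)
    rw [Submodule.map_smul''] at this
    simpa using Submodule.smul_mono le_rfl le_top this

variable [Fintype σ]

/-- The differential of the Tate construction: on `V` it is the linear form `x`, and it sends the
variable with index `i` to `z i`. -/
def differential (x : Module.Dual R V) (z : σ → V) : TateModule R V σ →ₗ[R] TateModule R V σ :=
  mapCoeff (CliffordAlgebra.contractLeft x) +
    ∑ i, mapCoeff (LinearMap.mulLeft R (ExteriorAlgebra.ι R (z i))) ∘ₗ partialDeriv R V i

variable (x : Module.Dual R V) (z : σ → V)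

theorem differential_apply (t : TateModule R V σ) (b : Multiset σ) :
    differential x z t b = CliffordAlgebra.contractLeft x (t b) +
      ∑ i, ExteriorAlgebra.ι R (z i) * t (i ::ₘ b) := by
  simp [differential]

/-- Removing one variable from a monomial does not depend on the order of removal. Hence derivatives
are chain maps, to be compared with the cohomology operators. -/
theorem partialDeriv_differential (i : σ) (t : TateModule R V σ) :
    partialDeriv R V i (differential x z t) = differential x z (partialDeriv R V i t) := by
  ext b
  simp only [partialDeriv_apply, differential_apply]
  simp_rw [Multiset.cons_swap i]

/-- A symmetric family is summed against the alternating products of the `z i`, so the terms cancel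
in pairs. -/
theorem sum_sum_ι_mul_eq_zero (w : σ → σ → ExteriorAlgebra R V) (hw : ∀ i j, w i j = w j i) :
    ∑ i, ∑ j, ExteriorAlgebra.ι R (z i) * (ExteriorAlgebra.ι R (z j) * w i j) = 0 := by
  classical
  rw [← Fintype.sum_prod_type' (f := fun i j ↦
    ExteriorAlgebra.ι R (z i) * (ExteriorAlgebra.ι R (z j) * w i j))]
  refine Finset.sum_involution (fun p _ ↦ p.swap) ?_ ?_ (by simp) (by simp)
  · rintro ⟨i, j⟩ -
    simp only [Prod.swap]
    rw [hw j i, ← mul_assoc, ← mul_assoc, ← add_mul, ExteriorAlgebra.ι_add_mul_swap, zero_mul]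
  · rintro ⟨i, j⟩ - h heq
    obtain rfl : j = i := congrArg Prod.fst heq
    apply h
    rw [← mul_assoc, ExteriorAlgebra.ι_sq_zero, zero_mul]

/-- Contraction squares to zero and the double sum over variables is alternating. The cross terms
cancel because contraction is an antiderivation killing the cycles `z i`. -/
theorem differential_comp_differential (hz : ∀ i, x (z i) = 0) :
    differential x z ∘ₗ differential x z = 0 := by
  refine LinearMap.ext fun t ↦ Finsupp.ext fun b ↦ ?_
  have := sum_sum_ι_mul_eq_zero z (fun i j ↦ t (j ::ₘ i ::ₘ b))
    fun i j ↦ by rw [Multiset.cons_swap]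
  simp only [LinearMap.comp_apply, differential_apply, map_add,
    CliffordAlgebra.contractLeft_contractLeft, mul_add, Finset.sum_add_distrib, Finset.mul_sum,
    map_sum]
  simp_rw [ExteriorAlgebra.ι, CliffordAlgebra.contractLeft_ι_mul, hz, zero_smul]
  simp_rw [ExteriorAlgebra.ι] at this
  rw [this]
  simp

theorem differential_single_one :
    differential x z (Finsupp.single b 1) =
      ∑ i, mapCoeff (LinearMap.mulLeft R (ExteriorAlgebra.ι R (z i)))
        (partialDeriv R V i (Finsupp.single b 1)) := by
  have : CliffordAlgebra.contractLeft x (1 : ExteriorAlgebra R V) = 0 :=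
    CliffordAlgebra.contractLeft_one _ _
  simp [differential, this]

theorem ι_mul_mem_smul_top {𝔞 : Ideal R} {v : V} (hv : v ∈ 𝔞 • (⊤ : Submodule R V))
    (ω : ExteriorAlgebra R V) :
    LinearMap.mulLeft R (ExteriorAlgebra.ι R v) ω ∈
      𝔞 • (⊤ : Submodule R (ExteriorAlgebra R V)) := by
  have := Submodule.mem_map_of_mem (f := LinearMap.mulRight R ω ∘ₗ ExteriorAlgebra.ι R) hv
  rw [Submodule.map_smul''] at this
  simpa using Submodule.smul_mono le_rfl le_top this

theorem contractLeft_mem_smul_top {𝔞 : Ideal R} (hx : ∀ v, x v ∈ 𝔞) (ω : ExteriorAlgebra R V) :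
    CliffordAlgebra.contractLeft x ω ∈ 𝔞 • (⊤ : Submodule R (ExteriorAlgebra R V)) := by
  induction ω using CliffordAlgebra.left_induction with
  | algebraMap r => rw [CliffordAlgebra.contractLeft_algebraMap]; exact zero_mem _
  | add ω η hω hη => rw [map_add]; exact add_mem hω hη
  | ι_mul ω v hω =>
    rw [CliffordAlgebra.contractLeft_ι_mul]
    refine sub_mem (Submodule.smul_mem_smul (hx v) trivial) ?_
    have := Submodule.mem_map_of_mem
      (f := LinearMap.mulLeft R (CliffordAlgebra.ι (0 : QuadraticForm R V) v)) hω
    rw [Submodule.map_smul''] at this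
    exact Submodule.smul_mono le_rfl le_top this

/-- For `𝔞 = 𝔪` this is minimality: every linear map from the Tate module to `k` vanishes on
boundaries. This allows the Tate module to be used ungraded, with the same module in every degree.
-/
theorem differential_mem_smul_top {𝔞 : Ideal R} (hx : ∀ v, x v ∈ 𝔞)
    (hz : ∀ i, z i ∈ 𝔞 • (⊤ : Submodule R V)) (t : TateModule R V σ) :
    differential x z t ∈ 𝔞 • (⊤ : Submodule R (TateModule R V σ)) := by
  simp only [differential, LinearMap.add_apply, LinearMap.sum_apply, LinearMap.comp_apply]
  exact add_mem (mapCoeff_mem_smul_top (contractLeft_mem_smul_top x hx) t)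
    (sum_mem fun i _ ↦ mapCoeff_mem_smul_top (ι_mul_mem_smul_top (hz i)) _)

/-- Contraction kills `1`, so only the coefficients of the `z i` enter and no condition on `x` is
needed. The ideal `𝔞` can therefore be much smaller than `𝔪`. -/
theorem differential_single_one_mem_smul_top {𝔞 : Ideal R}
    (hz : ∀ i, z i ∈ 𝔞 • (⊤ : Submodule R V)) (b : Multiset σ) :
    differential x z (Finsupp.single b 1) ∈ 𝔞 • (⊤ : Submodule R (TateModule R V σ)) := by
  rw [differential_single_one]
  exact sum_mem fun i _ ↦ mapCoeff_mem_smul_top (ι_mul_mem_smul_top (hz i)) _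

variable (R V σ) in
/-- The coefficient of the trivial monomial, projected to degree zero. -/
def scalarCoeff : TateModule R V σ →ₗ[R] R :=
  ExteriorAlgebra.algebraMapInv.toLinearMap ∘ₗ Finsupp.lapply 0

variable (R V σ) in
/-- The coefficient of the trivial monomial, projected to degree one. -/
def vectorCoeff : TateModule R V σ →ₗ[R] V :=
  ExteriorAlgebra.ιInv ∘ₗ Finsupp.lapply 0

/-- The degree one relations given by the Koszul complex of the linear form `x`. -/
def koszulRelations : Submodule R V :=
  Submodule.span R (Set.range fun p : V × V ↦ x p.1 • p.2 - x p.2 • p.1)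

theorem koszulRelations_le_ker : koszulRelations x ≤ LinearMap.ker x := by
  refine Submodule.span_le.2 ?_
  rintro _ ⟨⟨v, w⟩, rfl⟩
  simp [mul_comm]

theorem ιInv_ι_mul (v : V) (ω : ExteriorAlgebra R V) :
    ExteriorAlgebra.ιInv (ExteriorAlgebra.ι R v * ω) =
      ExteriorAlgebra.algebraMapInv ω • v := by
  let : Module Rᵐᵒᵖ V := Module.compHom _ ((RingHom.id R).fromOpposite mul_comm)
  have : IsCentralScalar R V := ⟨fun r m => rfl⟩
  have h : (TrivSqZeroExt.fstHom R R V).comp ExteriorAlgebra.toTrivSqZeroExt =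
      ExteriorAlgebra.algebraMapInv := by
    ext v
    simp [ExteriorAlgebra.algebraMapInv]
  have h' := DFunLike.congr_fun h ω
  simp only [AlgHom.comp_apply, TrivSqZeroExt.fstHom_apply] at h'
  simp [ExteriorAlgebra.ιInv, h']

theorem algebraMapInv_ι_mul (v : V) (ω : ExteriorAlgebra R V) :
    ExteriorAlgebra.algebraMapInv (ExteriorAlgebra.ι R v * ω) = 0 := by
  simp [ExteriorAlgebra.algebraMapInv]

theorem algebraMapInv_contractLeft (ω : ExteriorAlgebra R V) :
    ExteriorAlgebra.algebraMapInv (R := R) (M := V) (CliffordAlgebra.contractLeft x ω) =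
      x (ExteriorAlgebra.ιInv ω) := by
  induction ω using CliffordAlgebra.left_induction with
  | algebraMap r =>
    rw [CliffordAlgebra.contractLeft_algebraMap, map_zero]
    let : Module Rᵐᵒᵖ V := Module.compHom _ ((RingHom.id R).fromOpposite mul_comm)
    have : IsCentralScalar R V := ⟨fun r m => rfl⟩
    have : ExteriorAlgebra.ιInv (algebraMap R (ExteriorAlgebra R V) r) = 0 := by
      simp [ExteriorAlgebra.ιInv, TrivSqZeroExt.algebraMap_eq_inl]
    rw [this, map_zero]
  | add ω η hω hη => simp only [map_add, hω, hη]
  | ι_mul ω v hω =>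
    rw [CliffordAlgebra.contractLeft_ι_mul, map_sub]
    have h1 := algebraMapInv_ι_mul v (CliffordAlgebra.contractLeft x ω)
    have h2 := ιInv_ι_mul v ω
    rw [ExteriorAlgebra.ι] at h1 h2
    rw [h1, h2]
    simp [mul_comm]

/-- In degree one, contracting `v ω` gives `x(v) u - x(u) v`, where `u` is the linear part of `ω`: a
Koszul relation. -/
theorem ιInv_contractLeft_mem (ω : ExteriorAlgebra R V) :
    ExteriorAlgebra.ιInv (R := R) (M := V) (CliffordAlgebra.contractLeft x ω) ∈
      koszulRelations x := by
  induction ω using CliffordAlgebra.left_induction with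
  | algebraMap r => rw [CliffordAlgebra.contractLeft_algebraMap, map_zero]; exact zero_mem _
  | add ω η hω hη => rw [map_add, map_add]; exact add_mem hω hη
  | ι_mul ω v hω =>
    rw [CliffordAlgebra.contractLeft_ι_mul, map_sub]
    have h := ιInv_ι_mul v (CliffordAlgebra.contractLeft x ω)
    rw [ExteriorAlgebra.ι] at h
    rw [h, algebraMapInv_contractLeft, map_smul]
    exact Submodule.subset_span ⟨(v, _), rfl⟩

theorem scalarCoeff_differential (t : TateModule R V σ) :
    scalarCoeff R V σ (differential x z t) = x (vectorCoeff R V σ t) := by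
  simp [scalarCoeff, vectorCoeff, differential_apply, algebraMapInv_contractLeft,
    algebraMapInv_ι_mul]

/-- Modulo Koszul boundaries, the linear part of a boundary reads off the coefficients of the
divided power variables. Functionals dual to the `z i` thus recover derivatives. -/
theorem vectorCoeff_differential (t : TateModule R V σ) :
    vectorCoeff R V σ (differential x z t) - ∑ i, scalarCoeff R V σ (partialDeriv R V i t) • z i ∈
      koszulRelations x := by
  simpa [scalarCoeff, vectorCoeff, differential_apply, ιInv_ι_mul] using
    ιInv_contractLeft_mem x (t 0)

end TateModule

end Tate

/-! ### Cohomology operators and the monomials they detect. -/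

section Detection

variable {R : Type*} [CommRing R] [IsLocalRing R]

theorem map_eq_zero_of_mem_maximalIdeal_smul_top {A : Type*} [AddCommGroup A] [Module R A]
    (f : A →ₗ[R] ResidueField R) {a : A} (ha : a ∈ maximalIdeal R • (⊤ : Submodule R A)) :
    f a = 0 := by
  induction ha using Submodule.smul_induction_on' with
  | smul r hr a _ =>
    rw [map_smul, Algebra.smul_def, ResidueField.algebraMap_eq, (residue_eq_zero_iff r).2 hr,
      zero_mul]
  | add a _ b _ ha hb => rw [map_add, ha, hb, add_zero]

/-- Iterated derivatives. -/
def TateModule.iteratedDeriv (R : Type*) [CommRing R] (V : Type*) [AddCommGroup V] [Module R V]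
    {σ : Type*} : List σ → TateModule R V σ →ₗ[R] TateModule R V σ
  | [] => LinearMap.id
  | i :: l => iteratedDeriv R V l ∘ₗ partialDeriv R V i

theorem TateModule.iteratedDeriv_apply {R : Type*} [CommRing R] {V : Type*} [AddCommGroup V]
    [Module R V] {σ : Type*} (l : List σ) (t : TateModule R V σ) (b : Multiset σ) :
    iteratedDeriv R V l t b = t (l + b) := by
  induction l generalizing t with
  | nil => simp [iteratedDeriv]
  | cons i l ih =>
    simp [iteratedDeriv, ih, ← Multiset.cons_coe, Multiset.cons_add]

variable {V : Type*} [AddCommGroup V] [Module R V] [Module.Free R V] {σ : Type*} [Fintype σ]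
  [DecidableEq σ]
  {P : ℕ → Type*} [∀ n, AddCommGroup (P n)] [∀ n, Module R (P n)] [∀ n, Module.Projective R (P n)]
  {δ : ∀ n, P (n + 1) →ₗ[R] P n} {ε : P 0 →ₗ[R] ResidueField R}

open TateModule in
/-- The cohomology operators on a resolution of the residue field detect the divided power
monomials. -/
theorem exists_cocycle_detecting (hε : Function.Surjective ε) (h0 : Function.Exact (δ 0) ε)
    (hδ : ∀ n, Function.Exact (δ (n + 1)) (δ n))
    (x : Module.Dual R V) (hx : LinearMap.range x = maximalIdeal R)
    (z : σ → V) (hz : ∀ i, x (z i) = 0) (hzm : ∀ i, z i ∈ maximalIdeal R • (⊤ : Submodule R V))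
    (l : σ → LinearMap.ker x →ₗ[R] ResidueField R)
    (hl : ∀ i j, l i ⟨z j, hz j⟩ = if i = j then 1 else 0)
    (hlk : ∀ i, ∀ v (hv : v ∈ koszulRelations x), l i ⟨v, koszulRelations_le_ker x hv⟩ = 0) :
    ∃ φ : ∀ n, TateModule R V σ →ₗ[R] P n,
      (∀ n, δ n ∘ₗ φ (n + 1) = φ n ∘ₗ differential x z) ∧
      ∀ w : List σ, ∃ e : P (2 * w.length) →ₗ[R] ResidueField R, e ∘ₗ δ (2 * w.length) = 0 ∧
        ∀ t, e (φ (2 * w.length) t) = residue R (scalarCoeff R V σ (iteratedDeriv R V w t)) := by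
  have hδδ : ∀ n, δ n ∘ₗ δ (n + 1) = 0 := fun n ↦ (hδ n).linearMap_comp_eq_zero
  have hxm : ∀ v, x v ∈ maximalIdeal R := fun v ↦ hx ▸ LinearMap.mem_range_self x v
  have hd := differential_comp_differential x z hz
  have hdm := differential_mem_smul_top x z hxm hzm
  let q : R →ₗ[R] ResidueField R := Algebra.linearMap R (ResidueField R)
  have hq : ∀ r, q r = residue R r := fun r ↦ rfl
  have hexq : Function.Exact x q := fun r ↦ by
    rw [hq, residue_eq_zero_iff, ← hx]; rfl
  have hqs : Function.Surjective q := residue_surjective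
  -- comparison of the Tate module with the resolution
  obtain ⟨φ, hφ0, hφ⟩ := exists_chainMap_lift (A := fun _ ↦ TateModule R V σ)
    (d := fun _ ↦ differential x z) hε h0 hδ (fun _ ↦ hd) (q ∘ₗ scalarCoeff R V σ)
    (LinearMap.ext fun t ↦
      map_eq_zero_of_mem_maximalIdeal_smul_top (q ∘ₗ scalarCoeff R V σ) (hdm t))
  refine ⟨φ, hφ, ?_⟩
  -- comparison of the resolution with `V → R → k`
  obtain ⟨ψ₀, hψ₀⟩ := Module.projective_lifting_property q ε hqs
  obtain ⟨ψ₁, hψ₁⟩ := exists_comp_eq_of_exact hexq (ψ₀ ∘ₗ δ 0)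
    (by rw [← LinearMap.comp_assoc, hψ₀, h0.linearMap_comp_eq_zero])
  obtain ⟨h, hh⟩ := exists_comp_eq_of_exact hexq (ψ₀ ∘ₗ φ 0 - scalarCoeff R V σ)
    (by rw [LinearMap.comp_sub, ← LinearMap.comp_assoc, hψ₀, hφ0, sub_self])
  have hψδ : ∀ p, ψ₁ (δ 1 p) ∈ LinearMap.ker x := fun p ↦ by
    have := LinearMap.congr_fun hψ₁ (δ 1 p)
    have h' := LinearMap.congr_fun (hδδ 0) p
    simp only [LinearMap.comp_apply, LinearMap.zero_apply] at this h'
    rw [LinearMap.mem_ker, this, h', map_zero]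
  -- The map `ψ₁ ∘ δ 1` carries `P 2` to Koszul 1-cycles, on which `l i` is defined.
  let χ : σ → P 2 →ₗ[R] ResidueField R := fun i ↦ l i ∘ₗ (ψ₁ ∘ₗ δ 1).codRestrict _ hψδ
  have hχδ : ∀ i, χ i ∘ₗ δ 2 = 0 := fun i ↦ LinearMap.ext fun p ↦ by
    have h' : δ 1 (δ 2 p) = 0 := LinearMap.congr_fun (hδδ 1) p
    have : (ψ₁ ∘ₗ δ 1).codRestrict _ hψδ (δ 2 p) = 0 := Subtype.ext (by simp [h'])
    simp only [χ, LinearMap.comp_apply, this, map_zero, LinearMap.zero_apply]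
  have hχφ : ∀ i t, χ i (φ 2 t) = q (scalarCoeff R V σ (partialDeriv R V i t)) := fun i t ↦ by
    -- The composite `P → Koszul` after `Tate → P` agrees with the projection to the Koszul complex
    -- up to the homotopy `h` and a cycle-valued remainder. On boundaries `h` contributes zero and
    -- `l i` kills the remainder by minimality.
    have hw : ∀ t, (ψ₁ ∘ₗ φ 1 - vectorCoeff R V σ - h ∘ₗ differential x z) t ∈
        LinearMap.ker x := fun t ↦ by
      have h1 := LinearMap.congr_fun hψ₁ (φ 1 t)
      have h2 := LinearMap.congr_fun hh (differential x z t)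
      have h3 := LinearMap.congr_fun (hφ 0) t
      have h4 := scalarCoeff_differential x z t
      simp only [LinearMap.comp_apply, LinearMap.sub_apply, LinearMap.mem_ker, map_sub] at *
      rw [h1, h2, h3, h4]
      ring
    let w : TateModule R V σ →ₗ[R] LinearMap.ker x := LinearMap.codRestrict _ _ hw
    have hwd : l i (w (differential x z t)) = 0 :=
      map_eq_zero_of_mem_maximalIdeal_smul_top (l i ∘ₗ w) (hdm t)
    have hk := vectorCoeff_differential x z t
    have key : (ψ₁ ∘ₗ δ 1).codRestrict _ hψδ (φ 2 t) = w (differential x z t) +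
        (⟨_, koszulRelations_le_ker x hk⟩ +
          ∑ j, scalarCoeff R V σ (partialDeriv R V j t) • ⟨z j, hz j⟩) := by
      apply Subtype.ext
      have h3 := LinearMap.congr_fun (hφ 1) t
      have h5 := LinearMap.congr_fun hd t
      simp only [LinearMap.comp_apply, LinearMap.zero_apply] at h3 h5
      simp [w, h3, h5]
    simp only [χ, LinearMap.comp_apply, key, map_add, hwd, hlk i _ hk, map_sum, map_smul, hl]
    simp [q, Algebra.smul_def]
  -- the cohomology operators
  have hθ : ∀ i, ∃ θ : ∀ n, P (n + 2) →ₗ[R] P n, ε ∘ₗ θ 0 = χ i ∧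
      ∀ n, δ n ∘ₗ θ (n + 1) = θ n ∘ₗ δ (n + 2) := fun i ↦
    exists_chainMap_lift (A := fun n ↦ P (n + 2)) (d := fun n ↦ δ (n + 2)) hε h0 hδ
      (fun n ↦ hδδ (n + 2)) (χ i) (hχδ i)
  choose θ hθ0 hθ using hθ
  have hhom : ∀ i, ∃ g : ∀ n, TateModule R V σ →ₗ[R] P (n + 1),
      θ i 0 ∘ₗ φ 2 - φ 0 ∘ₗ partialDeriv R V i = δ 0 ∘ₗ g 0 ∧
      ∀ n, θ i (n + 1) ∘ₗ φ (n + 3) - φ (n + 1) ∘ₗ partialDeriv R V i =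
        δ (n + 1) ∘ₗ g (n + 1) + g n ∘ₗ differential x z := fun i ↦ by
    refine exists_homotopy_zero (A := fun _ ↦ TateModule R V σ) (d := fun _ ↦ differential x z)
      h0 hδ (fun _ ↦ hd) (fun n ↦ θ i n ∘ₗ φ (n + 2) - φ n ∘ₗ partialDeriv R V i) ?_ fun n ↦ ?_
    · rw [LinearMap.comp_sub, ← LinearMap.comp_assoc, ← LinearMap.comp_assoc, hθ0, hφ0]
      exact LinearMap.ext fun t ↦ by simp [hχφ]
    · rw [LinearMap.comp_sub, ← LinearMap.comp_assoc, ← LinearMap.comp_assoc, hθ, hφ,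
        LinearMap.sub_comp, LinearMap.comp_assoc, hφ (n + 2)]
      refine LinearMap.ext fun t ↦ ?_
      simp [partialDeriv_differential]
  choose g hg0 hg using hhom
  intro w
  induction w with
  | nil =>
    exact ⟨ε, h0.linearMap_comp_eq_zero, fun t ↦ LinearMap.congr_fun hφ0 t⟩
  | cons i w ih =>
    obtain ⟨e, heδ, he⟩ := ih
    refine ⟨e ∘ₗ θ i (2 * w.length), ?_, fun t ↦ ?_⟩
    · change (e ∘ₗ θ i (2 * w.length)) ∘ₗ δ (2 * w.length + 2) = 0
      rw [LinearMap.comp_assoc, ← hθ, ← LinearMap.comp_assoc, heδ, LinearMap.zero_comp]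
    · change e (θ i (2 * w.length) (φ (2 * w.length + 2) t)) =
        residue R (scalarCoeff R V σ (iteratedDeriv R V w (partialDeriv R V i t)))
      rw [← he]
      generalize 2 * w.length = n at e heδ he
      have heδ' : ∀ p, e (δ n p) = 0 := fun p ↦ LinearMap.congr_fun heδ p
      cases n with
      | zero =>
        have := congrArg e (LinearMap.congr_fun (hg0 i) t)
        simpa [heδ', sub_eq_zero] using this
      | succ n =>
        have := congrArg e (LinearMap.congr_fun (hg i n) t)
        -- Of the two homotopy terms, one dies because `e` is a cocycle and the other because Tate
        -- boundaries lie in `𝔪` times the module.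
        have h' := map_eq_zero_of_mem_maximalIdeal_smul_top (e ∘ₗ g i n) (hdm t)
        simp only [LinearMap.comp_apply] at h'
        simpa [heδ', sub_eq_zero, h'] using this

end Detection

/-! ### Independent classes in the homology of `M ⊗ P`. -/

section Rank

open TensorProduct TateModule

theorem tmul_eq_zero_of_mem_smul_top {R : Type*} [CommRing R] {M : Type*} [AddCommGroup M]
    [Module R M] {N : Type*} [AddCommGroup N] [Module R N] {𝔞 : Ideal R}
    {m : M} (hm : ∀ r ∈ 𝔞, r • m = 0) {p : N} (hp : p ∈ 𝔞 • (⊤ : Submodule R N)) :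
    m ⊗ₜ[R] p = 0 := by
  induction hp using Submodule.smul_induction_on' with
  | smul r hr p _ => rw [← smul_tmul, hm r hr, zero_tmul]
  | add p _ q _ hp hq => rw [tmul_add, hp, hq, add_zero]

variable {R : Type*} [CommRing R] [IsLocalRing R]
  {V : Type*} [AddCommGroup V] [Module R V] [Module.Free R V] {σ : Type*} [Fintype σ]
  [DecidableEq σ]
  {P : ℕ → Type*} [∀ n, AddCommGroup (P n)] [∀ n, Module R (P n)] [∀ n, Module.Projective R (P n)]
  {δ : ∀ n, P (n + 1) →ₗ[R] P n} {ε : P 0 →ₗ[R] ResidueField R}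
  {M : Type*} [AddCommGroup M] [Module R M]

/-- The homology of `M ⊗ P` in degree `2 * (n + 1)`, for a resolution `P` of the residue field,
maps onto a vector space with basis the monomials of degree `n + 1` in a family of cycles of the
Koszul complex which are linearly independent in homology and vanish modulo the annihilator
of `M`. -/
theorem exists_surjective_on_cycles (hε : Function.Surjective ε) (h0 : Function.Exact (δ 0) ε)
    (hδ : ∀ n, Function.Exact (δ (n + 1)) (δ n))
    (x : Module.Dual R V) (hx : LinearMap.range x = maximalIdeal R)
    {𝔞 : Ideal R} (h𝔞 : 𝔞 ≤ maximalIdeal R)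
    (z : σ → V) (hz : ∀ i, x (z i) = 0) (hzm : ∀ i, z i ∈ 𝔞 • (⊤ : Submodule R V))
    (l : σ → LinearMap.ker x →ₗ[R] ResidueField R)
    (hl : ∀ i j, l i ⟨z j, hz j⟩ = if i = j then 1 else 0)
    (hlk : ∀ i, ∀ v (hv : v ∈ koszulRelations x), l i ⟨v, koszulRelations_le_ker x hv⟩ = 0)
    (hM : 𝔞 ≤ Module.annihilator R M) (π : M →ₗ[R] ResidueField R) (m₀ : M) (hm₀ : π m₀ = 1)
    (n : ℕ) :
    ∃ Λ : M ⊗[R] P (2 * n + 2) →ₗ[R] (Sym σ (n + 1) → ResidueField R),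
      Λ ∘ₗ (δ (2 * n + 2)).lTensor M = 0 ∧
      ∀ f, ∃ y, (δ (2 * n + 1)).lTensor M y = 0 ∧ Λ y = f := by
  obtain ⟨φ, hφ, hw⟩ := exists_cocycle_detecting hε h0 hδ x hx z hz
    (fun i ↦ Submodule.smul_mono h𝔞 le_rfl (hzm i)) l hl hlk
  have he : ∀ a : Sym σ (n + 1), ∃ e : P (2 * n + 2) →ₗ[R] ResidueField R,
      e ∘ₗ δ (2 * n + 2) = 0 ∧
      ∀ b : Multiset σ, e (φ (2 * n + 2) (Finsupp.single b 1)) = if a = b then 1 else 0 := by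
    rintro ⟨a, ha⟩
    obtain ⟨w, rfl⟩ := Quot.exists_rep a
    have hw' := hw w
    rw [show w.length = n + 1 from ha] at hw'
    obtain ⟨e, h1, h2⟩ := hw'
    refine ⟨e, h1, fun b ↦ ?_⟩
    have := h2 (Finsupp.single b 1)
    refine this.trans ?_
    simp only [TateModule.scalarCoeff, LinearMap.comp_apply, Finsupp.lapply_apply,
      TateModule.iteratedDeriv_apply, add_zero, Finsupp.single_apply]
    change _ = if (w : Multiset σ) = b then _ else _
    by_cases h : b = w
    · simp [h]
    · simp [h, Ne.symm h]
  choose e heδ he using he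
  let L : Sym σ (n + 1) → M ⊗[R] P (2 * n + 2) →ₗ[R] ResidueField R := fun a ↦
    LinearMap.mul' R (ResidueField R) ∘ₗ TensorProduct.map π (e a)
  refine ⟨LinearMap.pi L, ?_, fun f ↦ ?_⟩
  · refine TensorProduct.ext' fun m p ↦ funext fun a ↦ ?_
    have : e a (δ (2 * n + 2) p) = 0 := LinearMap.congr_fun (heδ a) p
    simp [L, this]
  · choose r hr using fun a ↦ residue_surjective (f a)
    refine ⟨∑ a, r a • (m₀ ⊗ₜ φ (2 * n + 2) (Finsupp.single (a : Multiset σ) 1)), ?_, ?_⟩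
    · rw [map_sum]
      refine Finset.sum_eq_zero fun a _ ↦ ?_
      rw [map_smul, LinearMap.lTensor_tmul]
      have : δ (2 * n + 1) (φ (2 * n + 2) (Finsupp.single (a : Multiset σ) 1)) =
        φ (2 * n + 1) (_) := LinearMap.congr_fun (hφ (2 * n + 1)) _
      -- The boundary of a pure monomial has coefficients in `𝔞`, which annihilates `m₀`; hence the
      -- tensor is a cycle.
      have h := Submodule.mem_map_of_mem (f := φ (2 * n + 1))
        (TateModule.differential_single_one_mem_smul_top x z hzm (a : Multiset σ))
      rw [Submodule.map_smul''] at h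
      rw [this, tmul_eq_zero_of_mem_smul_top
        (fun r hr ↦ Module.mem_annihilator.1 (hM hr) m₀) (Submodule.smul_mono le_rfl le_top h),
        smul_zero]
    · ext a
      simp [L, hm₀, he, Algebra.smul_def, hr, Sym.coe_inj]

end Rank

/-! ### Vanishing of Tor above the length of a flat resolution. -/

section FlatDimension

open TensorProduct TateModule

variable {R : Type*} [CommRing R]
  {P : ℕ → Type*} [∀ n, AddCommGroup (P n)] [∀ n, Module R (P n)] [∀ n, Module.Flat R (P n)]
  {δ : ∀ n, P (n + 1) →ₗ[R] P n}

/-- Dimension shifting for the homology of `M ⊗ P`. -/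
theorem exact_lTensor_of_shortExact (hδ : ∀ n, Function.Exact (δ (n + 1)) (δ n))
    {K F M : Type*} [AddCommGroup K] [Module R K] [AddCommGroup F] [Module R F]
    [AddCommGroup M] [Module R M] [Module.Flat R F] {i : K →ₗ[R] F} {q : F →ₗ[R] M}
    (hi : Function.Injective i) (hiq : Function.Exact i q) (hq : Function.Surjective q) (n : ℕ)
    (hK : Function.Exact ((δ (n + 1)).lTensor K) ((δ n).lTensor K)) :
    Function.Exact ((δ (n + 2)).lTensor M) ((δ (n + 1)).lTensor M) := by
  have hF : ∀ n, Function.Exact ((δ (n + 1)).lTensor F) ((δ n).lTensor F) := fun n ↦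
    Module.Flat.lTensor_exact F (hδ n)
  refine fun y ↦ ⟨fun hy ↦ ?_, ?_⟩
  -- Diagram chase: lift the cycle to `F ⊗ P`. Its boundary comes from a cycle of `K ⊗ P` by
  -- flatness of `P n`, hence from a boundary, and correcting the lift by that preimage gives a
  -- cycle of the exact complex `F ⊗ P`.
  · obtain ⟨f, rfl⟩ := LinearMap.rTensor_surjective (P (n + 2)) hq y
    have hex := rTensor_exact (P (n + 1)) hiq hq
    have hf : q.rTensor (P (n + 1)) ((δ (n + 1)).lTensor F f) = 0 := by
      rw [← hy, ← LinearMap.comp_apply, ← LinearMap.comp_apply, LinearMap.rTensor_comp_lTensor,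
        LinearMap.lTensor_comp_rTensor]
    obtain ⟨g, hg⟩ := (hex _).1 hf
    have hg0 : (δ n).lTensor K g = 0 := by
      apply Module.Flat.rTensor_preserves_injective_linearMap (M := P n) i hi
      rw [map_zero, ← LinearMap.comp_apply, LinearMap.rTensor_comp_lTensor,
        ← LinearMap.lTensor_comp_rTensor, LinearMap.comp_apply, hg]
      exact (hF n).apply_apply_eq_zero f
    obtain ⟨g', rfl⟩ := (hK g).1 hg0
    have hff : (δ (n + 1)).lTensor F (f - i.rTensor _ g') = 0 := by
      rw [map_sub, sub_eq_zero, ← hg, ← LinearMap.comp_apply, ← LinearMap.comp_apply,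
        LinearMap.rTensor_comp_lTensor, LinearMap.lTensor_comp_rTensor]
    obtain ⟨f', hf'⟩ := (hF (n + 1) _).1 hff
    refine ⟨q.rTensor _ f', ?_⟩
    rw [← LinearMap.comp_apply, LinearMap.lTensor_comp_rTensor,
      ← LinearMap.rTensor_comp_lTensor, LinearMap.comp_apply, hf', map_sub, sub_eq_self]
    exact (rTensor_exact (P (n + 2)) hiq hq).apply_apply_eq_zero g'
  · rintro ⟨y, rfl⟩
    rw [← LinearMap.comp_apply, ← LinearMap.lTensor_comp, (hδ (n + 1)).linearMap_comp_eq_zero,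
      LinearMap.lTensor_zero, LinearMap.zero_apply]

/-- The homology of `M ⊗ P` vanishes in degrees larger than the length of a flat resolution
of `M`. -/
theorem exact_lTensor_of_flat_resolution (hδ : ∀ n, Function.Exact (δ (n + 1)) (δ n)) (n : ℕ) :
    ∀ {M : Type u} [AddCommGroup M] [Module R M] (F : ℕ → Type u) [∀ i, AddCommGroup (F i)]
      [∀ i, Module R (F i)] [∀ i, Module.Flat R (F i)] (d : ∀ i, F (i + 1) →ₗ[R] F i)
      (ε : F 0 →ₗ[R] M), (∀ i, n < i → Subsingleton (F i)) → Function.Surjective ε →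
      Function.Exact (d 0) ε → (∀ i, Function.Exact (d (i + 1)) (d i)) →
      ∀ j, n ≤ j → Function.Exact ((δ (j + 1)).lTensor M) ((δ j).lTensor M) := by
  induction n with
  | zero =>
    intro M _ _ F _ _ _ d ε hF hε h0 _ j _
    have := hF 1 one_pos
    have hinj : Function.Injective ε := (injective_iff_map_eq_zero ε).2 fun a ha ↦ by
      obtain ⟨b, rfl⟩ := (h0 a).1 ha
      rw [Subsingleton.elim b 0, map_zero]
    have : Module.Flat R M := Module.Flat.of_linearEquiv
      (LinearEquiv.ofBijective ε ⟨hinj, hε⟩).symm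
    exact Module.Flat.lTensor_exact M (hδ j)
  | succ n ih =>
    intro M _ _ F _ _ _ d ε hF hε h0 hd j hj
    obtain ⟨j, rfl⟩ := Nat.exists_eq_add_of_le' (Nat.one_le_of_lt hj)
    -- The first syzygy `ker ε` has the shifted, shorter flat resolution, to which induction
    -- applies.
    have hmem : ∀ a, d 0 a ∈ LinearMap.ker ε := fun a ↦ h0.apply_apply_eq_zero a
    refine exact_lTensor_of_shortExact hδ (LinearMap.ker ε).subtype_injective
      (LinearMap.exact_subtype_ker_map ε) hε j
      (ih (fun i ↦ F (i + 1)) (fun i ↦ d (i + 1)) ((d 0).codRestrict _ hmem)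
        (fun i hi ↦ hF (i + 1) (by lia)) ?_ ?_ (fun i ↦ hd (i + 1)) j (by lia))
    · rintro ⟨a, ha⟩
      obtain ⟨b, rfl⟩ := (h0 a).1 ha
      exact ⟨b, rfl⟩
    · intro a
      rw [← hd 0 a]
      exact Subtype.ext_iff
end FlatDimension

/-! ### From minimal relations in `Q` to Koszul cycles over `R`, with `S` in the role of the
completion. -/

section Relations

open TateModule

variable {R : Type*} [CommRing R] [IsLocalRing R] {Q : Type*} [CommRing Q] [IsLocalRing Q]
  {S : Type*} [CommRing S] {τ : R →+* S} {p : Q →+* S} {e : S →+* ResidueField R}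

theorem ker_comp_eq_maximalIdeal (hp : Function.Surjective p) (he : e.comp τ = residue R) :
    RingHom.ker (e.comp p) = maximalIdeal Q := by
  have hes : Function.Surjective e := fun a ↦ by
    obtain ⟨r, rfl⟩ := residue_surjective a
    exact ⟨τ r, RingHom.congr_fun he r⟩
  exact eq_maximalIdeal (RingHom.ker_isMaximal_of_surjective _ (hes.comp hp))

/-- Elements of a power of the maximal ideal of `R` lift to elements of the same power of the
maximal ideal of `Q`. -/
theorem exists_lift_mem_pow (hp : Function.Surjective p) (he : e.comp τ = residue R) {n : ℕ}
    {r : R} (hr : r ∈ maximalIdeal R ^ n) : ∃ q ∈ maximalIdeal Q ^ n, p q = τ r := by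
  have hle : (maximalIdeal R).map τ ≤ (maximalIdeal Q).map p := by
    refine Ideal.map_le_iff_le_comap.2 fun a ha ↦ ?_
    obtain ⟨q, hq⟩ := hp (τ a)
    rw [Ideal.mem_comap, Ideal.mem_map_iff_of_surjective p hp]
    refine ⟨q, ?_, hq⟩
    rw [← ker_comp_eq_maximalIdeal hp he, RingHom.mem_ker, RingHom.comp_apply, hq,
      ← RingHom.comp_apply, he]
    exact (residue_eq_zero_iff a).2 ha
  have := Ideal.pow_right_mono hle n (Ideal.map_pow τ _ n ▸ Ideal.mem_map_of_mem τ hr)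
  rwa [← Ideal.map_pow, Ideal.mem_map_iff_of_surjective p hp] at this

variable {ι : Type*} [Fintype ι] {a : ι → R} {b : ι → Q}

/-- Lifts of generators of the maximal ideal of `R` generate the maximal ideal of `Q`. -/
theorem span_range_eq_maximalIdeal [IsNoetherianRing Q] (hp : Function.Surjective p)
    (he : e.comp τ = residue R)
    (hdense : ∀ n s, ∃ r, ∃ q ∈ maximalIdeal Q ^ n, s = τ r + p q)
    (hker : RingHom.ker p ≤ maximalIdeal Q ^ 2)
    (ha : Ideal.span (Set.range a) = maximalIdeal R) (hab : ∀ i, p (b i) = τ (a i)) :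
    Ideal.span (Set.range b) = maximalIdeal Q := by
  have hmem : ∀ q, q ∈ maximalIdeal Q ↔ e (p q) = 0 := fun q ↦ by
    rw [← ker_comp_eq_maximalIdeal hp he, RingHom.mem_ker, RingHom.comp_apply]
  have heτ : ∀ r, e (τ r) = 0 ↔ r ∈ maximalIdeal R := fun r ↦ by
    rw [← RingHom.comp_apply, he, residue_eq_zero_iff]
  apply le_antisymm
  · refine Ideal.span_le.2 ?_
    rintro _ ⟨i, rfl⟩
    rw [SetLike.mem_coe, hmem, hab, heτ, ← ha]
    exact Ideal.subset_span ⟨i, rfl⟩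
  -- By Nakayama, generation modulo `𝔪_Q ^ 2` suffices, and there `ker p` is invisible.
  · refine Submodule.le_of_le_smul_of_le_jacobson_bot (IsNoetherian.noetherian _)
      (maximalIdeal_le_jacobson _) fun q hq ↦ ?_
    rw [smul_eq_mul, ← pow_two]
    obtain ⟨r, q', hq', h⟩ := hdense 2 (p q)
    have hr : r ∈ maximalIdeal R := by
      have h1 := congrArg e h
      rw [map_add, (hmem q).1 hq, (hmem q').1 (Ideal.pow_le_self two_ne_zero hq'), add_zero] at h1
      exact (heτ r).1 h1.symm
    rw [← ha] at hr
    obtain ⟨c, rfl⟩ := (Ideal.mem_span_range_iff_exists_fun).1 hr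
    choose C hC using fun i ↦ hp (τ (c i))
    have : q - (∑ i, C i * b i + q') ∈ RingHom.ker p := by
      rw [RingHom.mem_ker, map_sub, h]
      simp [hC, hab]
    have h2 := add_mem (hker this) hq'
    refine Submodule.mem_sup.2 ⟨∑ i, C i * b i, ?_, _, h2, by ring⟩
    exact sum_mem fun i _ ↦ Ideal.mul_mem_left _ _ (Ideal.subset_span ⟨i, rfl⟩)

/-- A functional on the kernel of `p` induces a functional on the relations between generators of
the maximal ideal of `R`, vanishing on the Koszul relations. -/
theorem exists_functional_on_relations (hp : Function.Surjective p) (he : e.comp τ = residue R)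
    (hab : ∀ i, p (b i) = τ (a i)) (hb : ∀ i, b i ∈ maximalIdeal Q)
    (μ : RingHom.ker p →ₛₗ[e.comp p] ResidueField R) :
    ∃ l : LinearMap.ker (Fintype.linearCombination R a) →ₗ[R] ResidueField R,
      (∀ v (w : RingHom.ker p) (W : ι → Q), (∀ i, p (W i) = τ (v.1 i)) →
        ∑ i, W i * b i = w → l v = μ w) ∧
      ∀ v (hv : v ∈ koszulRelations (Fintype.linearCombination R a)),
        l ⟨v, koszulRelations_le_ker _ hv⟩ = 0 := by
  classical
  let lift : S → Q := Function.surjInv hp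
  have hlift : ∀ s, p (lift s) = s := Function.surjInv_eq hp
  have hmem : ∀ v : LinearMap.ker (Fintype.linearCombination R a), ∀ W : ι → Q,
      (∀ i, p (W i) = τ (v.1 i)) → ∑ i, W i * b i ∈ RingHom.ker p := fun v W hW ↦ by
    have := congrArg τ v.2
    simp only [Fintype.linearCombination_apply, smul_eq_mul, map_sum, map_mul, map_zero] at this
    simp [RingHom.mem_ker, hW, hab, this]
  have hwell : ∀ (W : ι → Q) (hW : ∀ i, p (W i) = 0) (w : RingHom.ker p),
      ∑ i, W i * b i = w → μ w = 0 := fun W hW w hw ↦ by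
    have : w = ∑ i, b i • (⟨W i, hW i⟩ : RingHom.ker p) := Subtype.ext (by
      simp [← hw, mul_comm])
    rw [this, map_sum]
    refine Finset.sum_eq_zero fun i _ ↦ ?_
    have h0 : (e.comp p) (b i) = 0 := by
      rw [← RingHom.mem_ker, ker_comp_eq_maximalIdeal hp he]
      exact hb i
    rw [LinearMap.map_smulₛₗ, h0, zero_smul]
  let f : LinearMap.ker (Fintype.linearCombination R a) → ResidueField R := fun v ↦
    μ ⟨∑ i, lift (τ (v.1 i)) * b i, hmem v _ fun i ↦ hlift _⟩
  have hf : ∀ v (w : RingHom.ker p) (W : ι → Q), (∀ i, p (W i) = τ (v.1 i)) →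
        ∑ i, W i * b i = w → f v = μ w := fun v w W hW hw ↦ by
    rw [← sub_eq_zero, ← map_sub]
    refine hwell (fun i ↦ lift (τ (v.1 i)) - W i) (fun i ↦ by simp [hlift, hW]) _ ?_
    simp [sub_mul, hw]
  let l : LinearMap.ker (Fintype.linearCombination R a) →ₗ[R] ResidueField R :=
    { toFun := f
      map_add' := fun v w ↦ by
        rw [← map_add]
        refine hf (v + w) _ (fun i ↦ lift (τ (v.1 i)) + lift (τ (w.1 i))) (by simp [hlift]) ?_
        simp [add_mul, Finset.sum_add_distrib]
      map_smul' := fun r v ↦ by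
        have : (e.comp p) (lift (τ r)) = residue R r := by
          rw [RingHom.comp_apply, hlift, ← RingHom.comp_apply, he]
        rw [RingHom.id_apply, Algebra.smul_def, ResidueField.algebraMap_eq, ← this, ← smul_eq_mul,
          ← LinearMap.map_smulₛₗ]
        refine hf (r • v) _ (fun i ↦ lift (τ r) * lift (τ (v.1 i))) (by simp [hlift]) ?_
        simp [Finset.mul_sum, mul_assoc] }
  refine ⟨l, hf, fun v hv ↦ ?_⟩
  have hle : koszulRelations (Fintype.linearCombination R a) ≤
      (LinearMap.ker l).map (LinearMap.ker (Fintype.linearCombination R a)).subtype := by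
    refine Submodule.span_le.2 ?_
    rintro _ ⟨⟨v, w⟩, rfl⟩
    have hvw := koszulRelations_le_ker (Fintype.linearCombination R a)
      (Submodule.subset_span ⟨(v, w), rfl⟩)
    refine ⟨⟨_, hvw⟩, ?_, rfl⟩
    -- A Koszul relation has a lift of the same Koszul shape over `Q`, whose sum against `b` is
    -- exactly zero.
    have := hf ⟨_, hvw⟩ 0 (fun i ↦ (∑ j, lift (τ (v j)) * b j) * lift (τ (w i)) -
      (∑ j, lift (τ (w j)) * b j) * lift (τ (v i)))
      (fun i ↦ by simp [hlift, hab, Fintype.linearCombination_apply]) (by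
        simp_rw [sub_mul, Finset.sum_sub_distrib, mul_assoc, ← Finset.mul_sum]
        simp [mul_comm])
    rwa [map_zero] at this
  obtain ⟨w, hw, rfl⟩ := hle hv
  exact hw

variable {σ : Type*} [DecidableEq σ]

/-- Elements of `ker p ∩ 𝔪_Q ^ (c + 1)` which are linearly independent modulo `𝔪_Q (ker p)` yield
cycles in the Koszul complex of `R` with coefficients in `𝔪_R ^ c` which are linearly independent
in homology. -/
theorem exists_relations [IsNoetherianRing Q] (hp : Function.Surjective p)
    (he : e.comp τ = residue R)
    (hdense : ∀ n s, ∃ r, ∃ q ∈ maximalIdeal Q ^ n, s = τ r + p q)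
    (hinj : ∀ n r, ∀ q ∈ maximalIdeal Q ^ n, τ r = p q → r ∈ maximalIdeal R ^ n)
    (hker : RingHom.ker p ≤ maximalIdeal Q ^ 2)
    (ha : Ideal.span (Set.range a) = maximalIdeal R) {c : ℕ} {g : σ → Q} (hg : ∀ i, p (g i) = 0)
    (hgc : ∀ i, g i ∈ maximalIdeal Q ^ (c + 1))
    (μ : σ → RingHom.ker p →ₛₗ[e.comp p] ResidueField R)
    (hμ : ∀ i j, μ i ⟨g j, hg j⟩ = if i = j then 1 else 0) :
    ∃ (z : σ → ι → R) (hz : ∀ i, Fintype.linearCombination R a (z i) = 0)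
      (l : σ → LinearMap.ker (Fintype.linearCombination R a) →ₗ[R] ResidueField R),
      (∀ i, z i ∈ maximalIdeal R ^ c • (⊤ : Submodule R (ι → R))) ∧
      (∀ i j, l i ⟨z j, hz j⟩ = if i = j then 1 else 0) ∧
      ∀ i, ∀ v (hv : v ∈ koszulRelations (Fintype.linearCombination R a)),
        l i ⟨v, koszulRelations_le_ker _ hv⟩ = 0 := by
  classical
  choose b hab using fun i ↦ hp (τ (a i))
  have hspan := span_range_eq_maximalIdeal hp he hdense hker ha hab
  have hb : ∀ i, b i ∈ maximalIdeal Q := fun i ↦ hspan ▸ Ideal.subset_span ⟨i, rfl⟩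
  choose l hl hlk using fun i ↦ exists_functional_on_relations hp he hab hb (μ i)
  -- Artin–Rees: elements of `ker p` of high order lie in `𝔪_Q (ker p)`, so approximation errors are
  -- invisible to `μ`.
  obtain ⟨N₀, hN₀⟩ := Ideal.exists_pow_inf_eq_pow_smul (maximalIdeal Q) (RingHom.ker p)
  have hAR : ∀ q ∈ maximalIdeal Q ^ (N₀ + 1), ∀ hq : p q = 0, ∀ i, μ i ⟨q, hq⟩ = 0 := by
    intro q hq hq0 i
    have : q ∈ maximalIdeal Q • RingHom.ker p := by
      have h1 : q ∈ maximalIdeal Q ^ (N₀ + 1) • ⊤ ⊓ RingHom.ker p := by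
        refine ⟨?_, hq0⟩
        simpa using hq
      rw [hN₀ (N₀ + 1) (Nat.le_succ _), Nat.add_sub_cancel_left, pow_one] at h1
      exact Submodule.smul_mono le_rfl inf_le_right h1
    have h2 : (⟨q, hq0⟩ : RingHom.ker p) ∈ maximalIdeal Q • (⊤ : Submodule Q (RingHom.ker p)) := by
      have h3 : Submodule.map (RingHom.ker p).subtype
          (maximalIdeal Q • (⊤ : Submodule Q (RingHom.ker p))) = maximalIdeal Q • RingHom.ker p := by
        rw [Submodule.map_smul'', Submodule.map_subtype_top]
      rw [← h3] at this
      obtain ⟨y, hy, rfl⟩ := this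
      exact hy
    generalize (⟨q, hq0⟩ : RingHom.ker p) = y at h2
    induction h2 using Submodule.smul_induction_on' with
    | smul r hr y _ =>
      rw [LinearMap.map_smulₛₗ, RingHom.mem_ker.1 (ker_comp_eq_maximalIdeal hp he ▸ hr), zero_smul]
    | add y _ y' _ hy hy' => rw [map_add, hy, hy', add_zero]
  set N := max c (N₀ + 1)
  have hgb : ∀ i, ∃ A : ι → Q, (∀ j, A j ∈ maximalIdeal Q ^ c) ∧ ∑ j, A j * b j = g i := by
    intro i
    have h1 := hgc i
    rw [pow_succ, ← smul_eq_mul] at h1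
    nth_rw 2 [← hspan] at h1
    obtain ⟨A, hA, h2⟩ := (Submodule.mem_ideal_smul_span_iff_exists_sum _ _ _).1 h1
    refine ⟨A, hA, ?_⟩
    rw [← h2, Finsupp.sum_fintype _ _ (by simp)]
    rfl
  choose A hA hAg using hgb
  choose w q hq hw using fun i j ↦ hdense N (p (A i j))
  have hτw : ∀ i j, τ (w i j) = p (A i j - q i j) := fun i j ↦ by rw [map_sub, hw]; ring
  -- The approximation `w i` need not be a cycle, but its image under the Koszul differential lies
  -- in `𝔪 ^ (N + 1)`: the error is in `𝔪_Q ^ N` and each `b j` adds one order. So it can be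
  -- corrected by `u` with coefficients in `𝔪 ^ N`.
  have hwx : ∀ i, ∃ u : ι → R, (∀ j, u j ∈ maximalIdeal R ^ N) ∧ ∑ j, u j * a j =
      ∑ j, w i j * a j := fun i ↦ by
    have h1 : τ (∑ j, w i j * a j) = p (-∑ j, q i j * b j) := by
      have h3 := congrArg p (hAg i)
      rw [hg] at h3
      simp only [map_sum, map_mul, hab, hτw, map_neg, map_sub, sub_mul, Finset.sum_sub_distrib]
        at h3 ⊢
      rw [h3, zero_sub]
    have h2 := hinj (N + 1) _ _ (neg_mem (sum_mem fun j _ ↦ by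
      rw [pow_succ]; exact Ideal.mul_mem_mul (hq i j) (hb j))) h1
    rw [pow_succ, ← smul_eq_mul] at h2
    nth_rw 2 [← ha] at h2
    obtain ⟨u, hu, h2⟩ := (Submodule.mem_ideal_smul_span_iff_exists_sum _ _ _).1 h2
    refine ⟨u, hu, ?_⟩
    rw [← h2, Finsupp.sum_fintype _ _ (by simp)]
    rfl
  choose u hu huw using hwx
  choose U hU hpU using fun i j ↦ exists_lift_mem_pow hp he (hu i j)
  have hz : ∀ i, Fintype.linearCombination R a (w i - u i) = 0 := fun i ↦ by
    simp [Fintype.linearCombination_apply, sub_mul, huw]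
  refine ⟨fun i ↦ w i - u i, hz, l, fun i ↦ ?_, fun i j ↦ ?_, hlk⟩
  · change w i - u i ∈ _
    rw [pi_eq_sum_univ (w i - u i)]
    refine sum_mem fun j _ ↦ Submodule.smul_mem_smul (sub_mem ?_ ?_) trivial
    · refine hinj c _ _ (sub_mem (hA i j) ?_) (hτw i j)
      exact Ideal.pow_le_pow_right (le_max_left _ _) (hq i j)
    · exact Ideal.pow_le_pow_right (le_max_left _ _) (hu i j)
  · have hrem : ∑ k, (q j k + U j k) * b k ∈ maximalIdeal Q ^ (N₀ + 1) :=
      sum_mem fun k _ ↦ Ideal.mul_mem_right _ _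
        (Ideal.pow_le_pow_right (le_max_right c _) (add_mem (hq j k) (hU j k)))
    have hrem0 : p (∑ k, (q j k + U j k) * b k) = 0 := by
      have h3 := congrArg p (hAg j)
      have h4 := congrArg τ (huw j)
      rw [hg] at h3
      simp only [map_sum, map_mul, map_add, add_mul, Finset.sum_add_distrib, hab, hpU, hτw,
        map_sub, sub_mul, Finset.sum_sub_distrib] at h3 h4 ⊢
      rw [h4, h3]
      ring
    rw [hl i ⟨_, hz j⟩ (⟨g j, hg j⟩ - ⟨_, hrem0⟩) (fun k ↦ A j k - (q j k + U j k)),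
      map_sub, hμ, hAR _ hrem, sub_zero]
    · intro k
      simp [hτw, hpU]
      ring
    · simp [sub_mul, hAg]

end Relations

/-! ### Lower bounds for the length of Tor from a resolution. -/

section ModuleCatResolution

open TensorProduct

variable {R : Type u} [CommRing R]

/-- A projective resolution in the category of modules whose tensor product with a module `M`
computes Tor. -/
theorem exists_projectiveResolution_tor (k : Type u) [AddCommGroup k] [Module R k] :
    ∃ (P : ℕ → Type u) (_ : ∀ n, AddCommGroup (P n)) (_ : ∀ n, Module R (P n))
      (δ : ∀ n, P (n + 1) →ₗ[R] P n) (ε : P 0 →ₗ[R] k), (∀ n, Module.Projective R (P n)) ∧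
      Function.Surjective ε ∧ Function.Exact (δ 0) ε ∧
      (∀ n, Function.Exact (δ (n + 1)) (δ n)) ∧
      ∀ (M : Type u) [AddCommGroup M] [Module R M] (n : ℕ) {N : Type u} [AddCommGroup N]
        [Module R N] (Λ : M ⊗[R] P (n + 1) →ₗ[R] N), Λ ∘ₗ (δ (n + 1)).lTensor M = 0 →
        (∀ f, ∃ y, (δ n).lTensor M y = 0 ∧ Λ y = f) →
        Module.length R N ≤ Module.length R (((Tor (ModuleCat.{u} R) (n + 1)).obj
          (ModuleCat.of R M)).obj (ModuleCat.of R k)) := by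
  obtain ⟨P⟩ := (inferInstance : HasProjectiveResolution (ModuleCat.of R k)).out
  refine ⟨fun n ↦ P.complex.X n, fun _ ↦ inferInstance, fun _ ↦ inferInstance,
    fun n ↦ (P.complex.d (n + 1) n).hom, (P.π.f 0).hom, fun n ↦ ?_, ?_, ?_, fun n ↦ ?_, ?_⟩
  · rw [IsProjective.iff_projective]
    exact P.projective n
  · exact (ModuleCat.epi_iff_surjective _).1 (inferInstance : Epi (P.π.f 0))
  · exact (ShortComplex.ShortExact.moduleCat_exact_iff_function_exact _).1 P.exact₀
  · exact (ShortComplex.ShortExact.moduleCat_exact_iff_function_exact _).1 (P.exact_succ n)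
  · intro M _ _ n N _ _ Λ hΛ hsurj
    let F := (MonoidalCategory.tensoringLeft (ModuleCat.{u} R)).obj (ModuleCat.of R M)
    let C := (F.mapHomologicalComplex (ComplexShape.down ℕ)).obj P.complex
    let S := ShortComplex.mk (C.d (n + 2) (n + 1)) (C.d (n + 1) n) (C.d_comp_d _ _ _)
    have i1 : ((Tor (ModuleCat.{u} R) (n + 1)).obj (ModuleCat.of R M)).obj (ModuleCat.of R k) ≅
        C.homology (n + 1) := P.isoLeftDerivedObj F (n + 1)
    have i2 : C.homology (n + 1) ≅ S.homology :=
      ShortComplex.homologyMapIso (C.isoSc' (n + 2) (n + 1) n (by simp) (by simp))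
    have i3 := S.moduleCatHomologyIso
    have i := (i1 ≪≫ i2 ≪≫ i3).toLinearEquiv
    rw [i.length_eq]
    let Λ' : LinearMap.ker S.g.hom →ₗ[R] N := Λ ∘ₗ (LinearMap.ker S.g.hom).subtype
    have hle : LinearMap.range S.moduleCatToCycles ≤ LinearMap.ker Λ' := by
      rintro _ ⟨y, rfl⟩
      exact LinearMap.congr_fun hΛ y
    refine Module.length_le_of_surjective ((LinearMap.range S.moduleCatToCycles).liftQ Λ' hle) ?_
    intro f
    obtain ⟨y, hy, rfl⟩ := hsurj f
    exact ⟨Submodule.Quotient.mk ⟨y, hy⟩, rfl⟩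

end ModuleCatResolution

/-! ### Dual functionals over the residue field. -/

section Functionals

/-- A linearly independent family of elements of `ker p`, modulo `𝔪_Q (ker p)`, admits a dual
family of functionals. -/
theorem exists_dual_functionals {R : Type*} [CommRing R] [IsLocalRing R] {Q : Type*} [CommRing Q]
    [IsLocalRing Q] {S : Type*} [CommRing S] {τ : R →+* S} {p : Q →+* S} {e : S →+* ResidueField R}
    {σ : Type*} [DecidableEq σ] (hp : Function.Surjective p) (he : e.comp τ = residue R)
    {g : σ → RingHom.ker p}
    (hg : LinearIndependent (Q ⧸ maximalIdeal Q) fun i ↦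
      (Submodule.Quotient.mk (g i) : RingHom.ker p ⧸
        maximalIdeal Q • (⊤ : Submodule Q (RingHom.ker p)))) :
    ∃ μ : σ → RingHom.ker p →ₛₗ[e.comp p] ResidueField R,
      ∀ i j, μ i (g j) = if i = j then 1 else 0 := by
  let : Field (Q ⧸ maximalIdeal Q) := Ideal.Quotient.field _
  choose f hf using fun i : σ ↦ LinearMap.exists_extend (Finsupp.lapply i ∘ₗ hg.repr)
  let ρ : Q ⧸ maximalIdeal Q →+* ResidueField R := Ideal.Quotient.lift _ (e.comp p) fun q hq ↦ by
    rwa [← RingHom.mem_ker, ker_comp_eq_maximalIdeal hp he]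
  refine ⟨fun i ↦
    { toFun := fun y ↦ ρ (f i (Submodule.Quotient.mk y))
      map_add' := fun y y' ↦ by rw [Submodule.Quotient.mk_add, map_add, map_add]
      map_smul' := fun q y ↦ by
        have : (Submodule.Quotient.mk (q • y) : RingHom.ker p ⧸
          maximalIdeal Q • (⊤ : Submodule Q (RingHom.ker p))) =
          (Ideal.Quotient.mk (maximalIdeal Q) q) • Submodule.Quotient.mk y := rfl
        rw [this, map_smul, smul_eq_mul, map_mul]
        rfl }, fun i j ↦ ?_⟩
  have h1 := LinearMap.congr_fun (hf i) ⟨_, Submodule.subset_span ⟨j, rfl⟩⟩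
  have h2 : hg.repr ⟨_, Submodule.subset_span ⟨j, rfl⟩⟩ = Finsupp.single j 1 :=
    hg.repr_eq_single j _ rfl
  simp only [LinearMap.comp_apply, Submodule.subtype_apply, Finsupp.lapply_apply] at h1
  change ρ (f i _) = _
  rw [h1]
  erw [h2]
  rw [Finsupp.single_apply]
  by_cases h : i = j
  · simp [h]
  · simp [h, Ne.symm h]

/-- A module which is not equal to its product with the maximal ideal maps onto the residue
field. -/
theorem exists_map_to_residueField {R : Type*} [CommRing R] [IsLocalRing R] {M : Type*}
    [AddCommGroup M] [Module R M] (hM : maximalIdeal R • (⊤ : Submodule R M) ≠ ⊤) :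
    ∃ (π : M →ₗ[R] ResidueField R) (m : M), π m = 1 := by
  obtain ⟨m, -, hm⟩ := SetLike.exists_of_lt (lt_top_iff_ne_top.2 hM)
  let : Field (R ⧸ maximalIdeal R) := Ideal.Quotient.field _
  have hm' : (Submodule.Quotient.mk m : M ⧸ maximalIdeal R • (⊤ : Submodule R M)) ≠ 0 := by
    rwa [Ne, Submodule.Quotient.mk_eq_zero]
  obtain ⟨f, hf⟩ : ∃ f : Module.Dual (R ⧸ maximalIdeal R)
      (M ⧸ maximalIdeal R • (⊤ : Submodule R M)), f (Submodule.Quotient.mk m) ≠ 0 := by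
    by_contra! h
    exact hm' ((Module.forall_dual_apply_eq_zero_iff (R ⧸ maximalIdeal R) _).1 h)
  let π : M →ₗ[R] ResidueField R :=
    { toFun := fun y ↦ (f (Submodule.Quotient.mk y) : R ⧸ maximalIdeal R)
      map_add' := fun y y' ↦ by rw [Submodule.Quotient.mk_add, map_add]; rfl
      map_smul' := fun r y ↦ by
        have : (Submodule.Quotient.mk (r • y) : M ⧸ maximalIdeal R • (⊤ : Submodule R M)) =
          (Ideal.Quotient.mk (maximalIdeal R) r) • Submodule.Quotient.mk y := rfl
        rw [this, map_smul]
        rfl }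
  have hπ : π m ≠ 0 := hf
  obtain ⟨r, hr⟩ := residue_surjective (π m)⁻¹
  refine ⟨π, r • m, ?_⟩
  rw [map_smul, Algebra.smul_def, ResidueField.algebraMap_eq, hr, inv_mul_cancel₀ hπ]

end Functionals

/-! ### Application to the completion of `R`. -/

namespace MinimalCohenPresentation

variable {R : Type u} [CommRing R] [IsLocalRing R] {Q : Type v} [CommRing Q] [IsRegularLocalRing Q]
  {t : ℕ} (P : MinimalCohenPresentation R Q t)

/-- The surjection onto the completion. -/
def toCompletion : Q →+* AdicCompletion (maximalIdeal R) R :=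
  P.equiv.toRingHom.comp (Ideal.Quotient.mk _)

theorem toCompletion_surjective : Function.Surjective P.toCompletion :=
  P.equiv.surjective.comp Ideal.Quotient.mk_surjective

theorem ker_toCompletion : RingHom.ker P.toCompletion = P.ker := by
  ext q
  rw [RingHom.mem_ker, toCompletion, RingHom.comp_apply]
  simp [ker, Ideal.Quotient.eq_zero_iff_mem]

variable (R) in
/-- The residue map of the completion. -/
def completionResidue : AdicCompletion (maximalIdeal R) R →+* ResidueField R :=
  (AdicCompletion.evalOneₐ (maximalIdeal R)).toRingHom

variable (R) in
theorem completionResidue_comp :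
    (completionResidue R).comp (algebraMap R (AdicCompletion (maximalIdeal R) R)) = residue R :=
  rfl

variable [IsNoetherianRing R]

/-- As `R` is noetherian, the kernel of `R̂ → R / 𝔪 ^ n` is `𝔪 ^ n R̂`, and elements of `𝔪 ^ n` lift
to `𝔪_Q ^ n`. -/
theorem completion_dense (n : ℕ) (s : AdicCompletion (maximalIdeal R) R) :
    ∃ r, ∃ q ∈ maximalIdeal Q ^ n,
      s = algebraMap R (AdicCompletion (maximalIdeal R) R) r + P.toCompletion q := by
  obtain ⟨r, hr⟩ := Submodule.Quotient.mk_surjective _ (AdicCompletion.eval (maximalIdeal R) R n s)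
  have hmem : s - algebraMap R (AdicCompletion (maximalIdeal R) R) r ∈
      maximalIdeal R ^ n • (⊤ : Submodule R (AdicCompletion (maximalIdeal R) R)) := by
    rw [AdicCompletion.pow_smul_top_eq_ker_eval (IsNoetherian.noetherian _), LinearMap.mem_ker,
      map_sub, ← hr, sub_eq_zero]
    rfl
  refine ⟨r, ?_⟩
  suffices ∀ y ∈ maximalIdeal R ^ n • (⊤ : Submodule R (AdicCompletion (maximalIdeal R) R)),
      ∃ q ∈ maximalIdeal Q ^ n, y = P.toCompletion q by
    obtain ⟨q, hq, h⟩ := this _ hmem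
    exact ⟨q, hq, by rw [← h]; ring⟩
  intro y hy
  induction hy using Submodule.smul_induction_on' with
  | smul a ha y _ =>
    obtain ⟨q, hq, hqa⟩ := exists_lift_mem_pow P.toCompletion_surjective
      (completionResidue_comp R) ha
    obtain ⟨q', rfl⟩ := P.toCompletion_surjective y
    exact ⟨q * q', Ideal.mul_mem_right _ _ hq, by rw [map_mul, hqa, Algebra.smul_def]⟩
  | add y _ y' _ hy hy' =>
    obtain ⟨q, hq, rfl⟩ := hy
    obtain ⟨q', hq', rfl⟩ := hy'
    exact ⟨q + q', add_mem hq hq', (map_add _ _ _).symm⟩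

/-- The image of `𝔪_Q` lies in the maximal ideal of `R̂`, which is `𝔪 R̂`; reducing to `R / 𝔪 ^ n`
then kills `r`. -/
theorem mem_pow_of_algebraMap_eq (n : ℕ) (r : R) (q : Q) (hq : q ∈ maximalIdeal Q ^ n)
    (h : algebraMap R (AdicCompletion (maximalIdeal R) R) r = P.toCompletion q) :
    r ∈ maximalIdeal R ^ n := by
  have hle : (maximalIdeal Q).map P.toCompletion ≤
      (maximalIdeal R).map (algebraMap R (AdicCompletion (maximalIdeal R) R)) := by
    rw [← AdicCompletion.maximalIdeal_eq_map, ← ker_comp_eq_maximalIdeal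
      P.toCompletion_surjective (completionResidue_comp R),
      ← ker_comp_eq_maximalIdeal (p := RingHom.id _) Function.surjective_id
        (completionResidue_comp R), Ideal.map_le_iff_le_comap]
    exact fun _ h ↦ h
  have h1 := Ideal.pow_right_mono hle n (Ideal.map_pow P.toCompletion _ n ▸
    Ideal.mem_map_of_mem P.toCompletion hq)
  rw [← h, ← Ideal.map_pow] at h1
  have h2 := Ideal.mem_map_of_mem (AdicCompletion.evalₐ (maximalIdeal R) n).toRingHom h1
  rw [Ideal.map_map] at h2
  have h3 : (AdicCompletion.evalₐ (maximalIdeal R) n).toRingHom.comp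
      (algebraMap R (AdicCompletion (maximalIdeal R) R)) =
      Ideal.Quotient.mk (maximalIdeal R ^ n) := by
    ext a
    simp
  rw [h3, ← RingHom.comp_apply, h3, Ideal.map_quotient_self] at h2
  exact Ideal.Quotient.eq_zero_iff_mem.1 h2

open TensorProduct in
/-- If `𝔪 ^ c` annihilates `M`, then elements of `ker ∩ 𝔪_Q ^ (c + 1)` which are part of a minimal
generating set give lower bounds for the homology of `M ⊗ X`, for a resolution `X` of the residue
field. -/
theorem exists_surjective_on_cycles {σ : Type*} [Fintype σ] [DecidableEq σ]
    {X : ℕ → Type*} [∀ n, AddCommGroup (X n)] [∀ n, Module R (X n)]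
    [∀ n, Module.Projective R (X n)]
    {δ : ∀ n, X (n + 1) →ₗ[R] X n} {ε : X 0 →ₗ[R] ResidueField R}
    (hε : Function.Surjective ε) (h0 : Function.Exact (δ 0) ε)
    (hδ : ∀ n, Function.Exact (δ (n + 1)) (δ n))
    {M : Type*} [AddCommGroup M] [Module R M]
    (hM : maximalIdeal R • (⊤ : Submodule R M) ≠ ⊤) {c : ℕ} (hc : c ≠ 0)
    (hMc : maximalIdeal R ^ c • (⊤ : Submodule R M) = ⊥)
    {g : σ → P.ker} (hgc : ∀ i, (g i : Q) ∈ maximalIdeal Q ^ (c + 1))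
    (hg : LinearIndependent (Q ⧸ maximalIdeal Q) fun i ↦
      (Submodule.Quotient.mk (g i) : P.ker ⧸ maximalIdeal Q • (⊤ : Submodule Q P.ker))) (n : ℕ) :
    ∃ Λ : M ⊗[R] X (2 * n + 2) →ₗ[R] (Sym σ (n + 1) → ResidueField R),
      Λ ∘ₗ (δ (2 * n + 2)).lTensor M = 0 ∧
      ∀ f, ∃ y, (δ (2 * n + 1)).lTensor M y = 0 ∧ Λ y = f := by
  obtain ⟨m, a, ha⟩ := Submodule.fg_iff_exists_fin_generating_family.1
    (IsNoetherian.noetherian (maximalIdeal R))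
  have hle := P.le_sq
  change P.ker ≤ _ at hle
  -- The types of `g` and of the quotient depend on the ideal, so it is made a variable before being
  -- identified with the kernel of the ring map.
  generalize hI : P.ker = I at g hgc hg hle
  rw [← P.ker_toCompletion] at hI
  subst hI
  obtain ⟨μ, hμ⟩ := exists_dual_functionals P.toCompletion_surjective (completionResidue_comp R) hg
  obtain ⟨z, hz, l, hzm, hl, hlk⟩ := exists_relations P.toCompletion_surjective
    (completionResidue_comp R) P.completion_dense P.mem_pow_of_algebraMap_eq hle ha
    (fun i ↦ (g i).2) hgc μ hμ
  obtain ⟨π, m₀, hm₀⟩ := exists_map_to_residueField hM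
  refine _root_.exists_surjective_on_cycles hε h0 hδ (Fintype.linearCombination R a) ?_
    (Ideal.pow_le_self hc) z hz hzm l hl hlk (fun r hr ↦ ?_) π m₀ hm₀ n
  · rw [Fintype.range_linearCombination, ← ha]
  · refine Module.mem_annihilator.2 fun y ↦ ?_
    rw [← Submodule.mem_bot R, ← hMc]
    exact Submodule.smul_mem_smul hr trivial

end MinimalCohenPresentation

/-! ### Loewy length, orders and growth. -/

section Loewy

theorem exists_pow_smul_eq_bot_of_loewyLength_lt {R : Type u} [CommRing R] [IsLocalRing R]
    {M : Type v} [AddCommGroup M] [Module R M] {o : ℕ∞} (h : loewyLength R M < o) :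
    ∃ c : ℕ, maximalIdeal R ^ c • (⊤ : Submodule R M) = ⊥ ∧ (c : ℕ∞) < o := by
  simp only [loewyLength, iInf_lt_iff] at h
  obtain ⟨c, hc, h⟩ := h
  exact ⟨c, hc, h⟩

theorem mem_pow_succ_of_lt_adicOrder {Q : Type v} [CommRing Q] [IsLocalRing Q] {g : Q} {c : ℕ}
    (h : (c : ℕ∞) < adicOrder g) : g ∈ maximalIdeal Q ^ (c + 1) := by
  simp only [adicOrder, lt_iSup_iff, Nat.cast_lt] at h
  obtain ⟨n, hn, h⟩ := h
  exact Ideal.pow_le_pow_right h hn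

/-- Nakayama for a nilpotent action, which needs no finiteness of `M`. -/
theorem smul_top_ne_top_of_pow_smul_eq_bot {R : Type*} [CommRing R] {M : Type*} [AddCommGroup M]
    [Module R M] [Nontrivial M] {𝔞 : Ideal R} {c : ℕ}
    (h : 𝔞 ^ c • (⊤ : Submodule R M) = ⊥) : 𝔞 • (⊤ : Submodule R M) ≠ ⊤ := fun htop ↦ by
  have : ∀ n, 𝔞 ^ n • (⊤ : Submodule R M) = ⊤ := fun n ↦ by
    induction n with
    | zero => simp
    | succ n ih => rw [pow_succ, mul_smul, htop, ih]
  exact top_ne_bot ((this c).symm.trans h)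

theorem ne_zero_of_pow_smul_eq_bot {R : Type*} [CommRing R] {M : Type*} [AddCommGroup M]
    [Module R M] [Nontrivial M] {𝔞 : Ideal R} {c : ℕ}
    (h : 𝔞 ^ c • (⊤ : Submodule R M) = ⊥) : c ≠ 0 := by
  rintro rfl
  simp at h

end Loewy

/-- The numbers of monomials of degree `N` in `r + 1` variables are not bounded by a polynomial of
degree less than `r` in `2 * N`. -/
theorem le_of_choose_le_zpow {r d : ℕ} {a : ℝ} (ha : 0 < a)
    (h : ∀ N : ℕ, 1 ≤ N → ((N + r).choose r : ℝ) ≤ a * ((2 * N : ℕ) : ℝ) ^ ((d : ℤ) - 1)) :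
    r + 1 ≤ d := by
  by_contra! hd
  -- From `N ^ r / r! ≤ (N + r).choose r ≤ a (2N) ^ (r - 1)` one gets `N ≤ r! a 2 ^ (r - 1)`, so any
  -- larger `N` gives a contradiction. Integer exponents cover `r = 0`.
  obtain ⟨N, hN⟩ := exists_nat_gt (r.factorial * a * (2 : ℝ) ^ ((r : ℤ) - 1))
  have hN0 : (0 : ℝ) < N := lt_trans (by positivity) hN
  have hN1 : 1 ≤ N := by exact_mod_cast hN0
  have hchoose : (N : ℝ) ^ r ≤ r.factorial * ((N + r).choose r : ℝ) := by
    have h1 := Nat.pow_le_choose (α := ℝ) r (N + r)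
    rw [div_le_iff₀' (by positivity)] at h1
    refine le_trans ?_ h1
    gcongr
    exact_mod_cast (by lia : N ≤ N + r + 1 - r)
  have h2N : (1 : ℝ) ≤ ((2 * N : ℕ) : ℝ) := by exact_mod_cast (by lia : 1 ≤ 2 * N)
  have hpow : ((2 * N : ℕ) : ℝ) ^ ((d : ℤ) - 1) ≤ ((2 * N : ℕ) : ℝ) ^ ((r : ℤ) - 1) :=
    zpow_le_zpow_right₀ h2N (by lia)
  have hsplit : (N : ℝ) ^ r = N * (N : ℝ) ^ ((r : ℤ) - 1) := by
    rw [← zpow_natCast, mul_comm, ← zpow_add_one₀ hN0.ne', sub_add_cancel]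
  have key : N * (N : ℝ) ^ ((r : ℤ) - 1) ≤
      (r.factorial * a * (2 : ℝ) ^ ((r : ℤ) - 1)) * (N : ℝ) ^ ((r : ℤ) - 1) := by
    calc N * (N : ℝ) ^ ((r : ℤ) - 1) ≤ r.factorial * ((N + r).choose r : ℝ) := hsplit ▸ hchoose
      _ ≤ r.factorial * (a * ((2 * N : ℕ) : ℝ) ^ ((r : ℤ) - 1)) := by
        gcongr
        exact (h N hN1).trans (by gcongr)
      _ = _ := by
        rw [Nat.cast_mul, mul_zpow]
        push_cast
        ring
  exact absurd (le_of_mul_le_mul_right key (by positivity)) (not_le.2 hN)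

/-! ### The two inequalities of the theorem. -/

namespace MinimalCohenPresentation

variable {R : Type u} [CommRing R] [IsLocalRing R] {Q : Type v} [CommRing Q] [IsRegularLocalRing Q]
  {t : ℕ} (P : MinimalCohenPresentation R Q t)

theorem f_mem_ker (i : Fin t) : P.f i ∈ P.ker := Ideal.subset_span ⟨i, rfl⟩

/-- The `t` classes span a space whose dimension, by Nakayama, is the minimal number of generators
`t`. -/
theorem linearIndependent_f :
    LinearIndependent (Q ⧸ maximalIdeal Q) fun i ↦
      (Submodule.Quotient.mk ⟨P.f i, P.f_mem_ker i⟩ :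
        P.ker ⧸ maximalIdeal Q • (⊤ : Submodule Q P.ker)) := by
  let : Field (Q ⧸ maximalIdeal Q) := Ideal.Quotient.field _
  refine linearIndependent_of_top_le_span_of_card_eq_finrank ?_ ?_
  · rintro y -
    obtain ⟨⟨y, hy⟩, rfl⟩ := Submodule.Quotient.mk_surjective _ y
    obtain ⟨c, hc⟩ := (Ideal.mem_span_range_iff_exists_fun).1 hy
    have : (⟨y, hy⟩ : P.ker) = ∑ i, c i • ⟨P.f i, P.f_mem_ker i⟩ := Subtype.ext (by simp [← hc])
    rw [this, ← Submodule.mkQ_apply, map_sum]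
    refine sum_mem fun i _ ↦ ?_
    rw [map_smul]
    exact Submodule.smul_mem _ (Ideal.Quotient.mk (maximalIdeal Q) (c i))
      (Submodule.subset_span (Set.mem_range_self i))
  · rw [Fintype.card_fin, ← spanFinrank_eq_finrank_quotient _ (IsNoetherian.noetherian _)]
    exact P.spanFinrank_eq.symm

variable [IsNoetherianRing R]

theorem choose_le_bettiNumber {r : ℕ} (P : MinimalCohenPresentation R Q (r + 1)) {M : Type u}
    [AddCommGroup M] [Module R M] [Nontrivial M] (h : loewyLength R M < P.ord) {N : ℕ}
    (hN : 1 ≤ N) : ((N + r).choose r : ℕ∞) ≤ bettiNumber R M (2 * N) := by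
  obtain ⟨n, rfl⟩ := Nat.exists_eq_add_of_le' hN
  obtain ⟨c, hMc, hc⟩ := exists_pow_smul_eq_bot_of_loewyLength_lt h
  obtain ⟨X, _, _, δ, ε, _, hε, h0, hδ, htor⟩ :=
    exists_projectiveResolution_tor (R := R) (ResidueField R)
  have hgc : ∀ i, P.f i ∈ maximalIdeal Q ^ (c + 1) := fun i ↦
    mem_pow_succ_of_lt_adicOrder (hc.trans_le (iInf₂_le _ (P.f_mem_ker i)))
  obtain ⟨Λ, hΛ, hsurj⟩ := P.exists_surjective_on_cycles hε h0 hδ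
    (smul_top_ne_top_of_pow_smul_eq_bot hMc) (ne_zero_of_pow_smul_eq_bot hMc) hMc hgc
    P.linearIndependent_f n
  refine le_trans (le_of_eq ?_) (htor M (2 * n + 1) Λ hΛ hsurj)
  have : IsSimpleModule R (ResidueField R) :=
    isSimpleModule_iff_quot_maximal.2 ⟨maximalIdeal R, inferInstance, ⟨LinearEquiv.refl _ _⟩⟩
  rw [Module.length_pi, Module.length_eq_one, mul_one, ENat.card_eq_coe_fintype_card,
    Sym.card_sym_eq_choose, Fintype.card_fin]
  congr 1
  rw [← Nat.choose_symm_add]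
  congr 1
  lia

theorem le_complexity {M : Type u} [AddCommGroup M] [Module R M] [Nontrivial M]
    (h : loewyLength R M < P.ord) : (t : ℕ∞) ≤ complexity R M := by
  cases t with
  | zero => simp
  | succ r =>
    refine le_iInf₂ fun d ⟨a, ha, hd⟩ ↦ Nat.cast_le.2 (le_of_choose_le_zpow ha fun N hN ↦ ?_)
    have h1 : (((N + r).choose r : ℕ∞) : ℝ≥0∞) ≤ (bettiNumber R M (2 * N) : ℕ∞) :=
      ENat.toENNReal_le.2 (P.choose_le_bettiNumber h hN)
    have h2 := h1.trans (hd (2 * N) (by lia))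
    rw [ENat.toENNReal_coe, ← ENNReal.ofReal_natCast] at h2
    exact (ENNReal.ofReal_le_ofReal_iff (by positivity)).1 h2

/-- A minimal generator of order above `c` gives a nonzero class in degree `2 * n + 2`, past the
length `n` of a flat resolution. -/
theorem maxOrd_le_loewyLength {M : Type u} [AddCommGroup M] [Module R M] [Nontrivial M]
    (hM : HasFiniteFlatDimension R M) : P.maxOrd ≤ loewyLength R M := by
  refine iSup₂_le fun g ⟨hg, hg'⟩ ↦ le_of_not_gt fun h ↦ ?_
  obtain ⟨c, hMc, hc⟩ := exists_pow_smul_eq_bot_of_loewyLength_lt h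
  obtain ⟨X, _, _, δ, ε, _, hε, h0, hδ, -⟩ :=
    exists_projectiveResolution_tor (R := R) (ResidueField R)
  have hli : LinearIndependent (Q ⧸ maximalIdeal Q) fun _ : Unit ↦
      (Submodule.Quotient.mk ⟨g, hg⟩ : P.ker ⧸ maximalIdeal Q • (⊤ : Submodule Q P.ker)) := by
    let : Field (Q ⧸ maximalIdeal Q) := Ideal.Quotient.field _
    refine linearIndependent_unique_iff.2 fun h0 ↦ hg' ?_
    rw [Submodule.Quotient.mk_eq_zero] at h0
    have := Submodule.mem_map_of_mem (f := P.ker.subtype) h0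
    rwa [Submodule.map_smul'', Submodule.map_subtype_top] at this
  obtain ⟨F, _, _, d, ε', n, hflat, hF, hε', h0', hd⟩ := hM
  have hex := exact_lTensor_of_flat_resolution hδ n F d ε' hF hε' h0' hd (2 * n + 1) (by lia)
  obtain ⟨Λ, hΛ, hsurj⟩ := P.exists_surjective_on_cycles hε h0 hδ
    (smul_top_ne_top_of_pow_smul_eq_bot hMc) (ne_zero_of_pow_smul_eq_bot hMc) hMc
    (fun _ ↦ mem_pow_succ_of_lt_adicOrder hc) hli n
  obtain ⟨y, hy, hy1⟩ := hsurj 1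
  obtain ⟨w, rfl⟩ := (hex y).1 hy
  have : Λ ((δ (2 * n + 2)).lTensor M w) = 0 := LinearMap.congr_fun hΛ w
  rw [hy1] at this
  exact one_ne_zero (congrFun this (Sym.replicate (n + 1) ()))

end MinimalCohenPresentation
end

theorem mainTheorem8 {R : Type u} [CommRing R] [IsLocalRing R] [IsNoetherianRing R]
    {Q : Type v} [CommRing Q] [IsRegularLocalRing Q] {t : ℕ}
    (P : MinimalCohenPresentation R Q t)
    (M : Type u) [AddCommGroup M] [Module R M] [Nontrivial M] :
    (Module.Finite R M → loewyLength R M < P.ord → (t : ℕ∞) ≤ complexity R M) ∧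
    (HasFiniteFlatDimension R M → maximalIdeal R • (⊤ : Submodule R M) ≠ ⊤ →
      P.maxOrd ≤ loewyLength R M) :=
  ⟨fun _ h ↦ P.le_complexity h, fun h _ ↦ P.maxOrd_le_loewyLength h⟩
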